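/- All graphs are finite and simple and have at least one vertex. For a graph $G$ write $v(G)$ for its number of vertices, $m_k(G)$ for the number of its matchings with exactly $k$ edges, $\mathbb M(G)=\sum_{k} m_k(G)$ for the number of all its matchings, and $$\mu(G,x)=\sum_{k=0}^{\lfloor v(G)/2\rfloor}(-1)^k m_k(G)\,x^{v(G)-2k}$$ for its matching polynomial. A pair $(G,d)$ is admissible if $d\ge 1$ is real and all degrees of $G$ are at most $d$. The matching measure $\rho_{G,d}$ of an admissible pair is the uniform distribution on the points $\lambda/\sqrt d$, where $\lambda$ runs over the roots of $\mu(G,x)$ with multiplicity. For a connected graph $F$ let $$t(F,G,d)=\frac{\hom(F,G)}{v(G)\,d^{\,v(F)-1}},$$ where $\hom(F,G)$ is the number of graph homomorphisms from $F$ to $G$. For $0\le\alpha\le1$, a sequence $(G_n,d_n)$ of admissible pairs is $\alpha$-regular if the degree of a uniform random vertex of $G_n$, divided by $d_n$, tends to $\alpha$ in probability. The semicircle distribution on $[-2\beta,2\beta]$ ($\beta\ge0$) is the law of $\beta X$, where $X$ has density $\frac1{2\pi}\sqrt{4-x^2}$ on $[-2,2]$; for $\beta=0$ it is the point mass at $0$.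 **Theorem.** Let $(G_n,d_n)$ be a sequence of admissible pairs with $d_n\to\infty$, and let $\rho_n=\rho_{G_n,d_n}$. All roots of the polynomials $\mu(G_n,x)$ are real, so the $\rho_n$ are probability measures on $\mathbb R$. Moreover: (a) If $t(F,G_n,d_n)$ converges as $n\to\infty$ for every finite tree $F$, then $\rho_n$ converges weakly to a probability measure $\rho$ supported on $[-2,2]$, and $$\limsup_{n\to\infty}\,\log\frac{\mathbb M(G_n)^{2/v(G_n)}}{d_n}\;\le\;2\int_{-2}^{2}\log|x|\,\mathrm d\rho(x),$$ where $\log 0=-\infty$ and both sides are extended real numbers, which may equal $-\infty$. (b) If the sequence $(G_n,d_n)$ is $\alpha$-regular for some $0\le\alpha\le1$, then $\rho_n$ converges weakly to the semicircle distribution on $[-2\sqrt\alpha,2\sqrt\alpha]$ (which is thus the measure $\rho$ of (a)), and $$\limsup_{n\to\infty}\,\frac{\mathbb M(G_n)^{2/v(G_n)}}{d_n}\;\le\;\frac{\alpha}{e}.$$ -/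

import Mathlib

open Filter Topology MeasureTheory
open scoped NNReal ENNReal Polynomial

namespace SimpleGraph

/-- `(G, d)` is an admissible pair: `d ≥ 1` is real and all degrees of `G` are at most `d`. -/
def IsAdmissible {V : Type*} [Fintype V] (G : SimpleGraph V) [DecidableRel G.Adj] (d : ℝ) :
    Prop :=
  1 ≤ d ∧ ∀ v, (G.degree v : ℝ) ≤ d

/-- The homomorphism density `hom(F, G) / (v(G) d ^ (v(F) - 1))` of a connected graph `F`. -/
noncomputable def homDensity {U V : Type*} [Fintype U] [Fintype V]
    (F : SimpleGraph U) (G : SimpleGraph V) (d : ℝ) : ℝ :=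
  (Nat.card (F →g G) : ℝ) / ((Fintype.card V : ℝ) * d ^ (Fintype.card U - 1))

/-- `m_k(G)`: the number of matchings of `G` consisting of exactly `k` edges. -/
noncomputable def numMatchings {V : Type*} (G : SimpleGraph V) (k : ℕ) : ℕ :=
  Nat.card {M : G.Subgraph // M.IsMatching ∧ M.edgeSet.ncard = k}

/-- `𝕄(G)`: the number of all matchings of `G`. -/
noncomputable def totalMatchings {V : Type*} [Fintype V] (G : SimpleGraph V) : ℕ :=
  ∑ k ∈ Finset.range (Fintype.card V / 2 + 1), G.numMatchings k

/-- The matching polynomial `∑ k ≤ v(G) / 2, (-1) ^ k m_k(G) x ^ (v(G) - 2 k)`. -/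
noncomputable def matchingPoly {V : Type*} [Fintype V] (G : SimpleGraph V) : ℝ[X] :=
  ∑ k ∈ Finset.range (Fintype.card V / 2 + 1),
    Polynomial.C ((-1 : ℝ) ^ k * (G.numMatchings k : ℝ)) *
      Polynomial.X ^ (Fintype.card V - 2 * k)

/-- The matching measure of `(G, d)`: mass `1 / v(G)` is put at `r / √d` for every root `r` of the
matching polynomial, with multiplicity. The polynomial has degree `v(G)`, so this has total mass
one exactly when all of its complex roots are real (as they are, by Heilmann and Lieb). -/
noncomputable def matchingMeasure {V : Type*} [Fintype V] (G : SimpleGraph V) (d : ℝ) :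
    Measure ℝ :=
  (Fintype.card V : ℝ≥0∞)⁻¹ •
    (G.matchingPoly.roots.map fun r => Measure.dirac (r / √d)).sum

instance isFiniteMeasure_matchingMeasure {V : Type*} [Fintype V] [Nonempty V]
    (G : SimpleGraph V) (d : ℝ) : IsFiniteMeasure (G.matchingMeasure d) := by
  have h : ∀ s : Multiset ℝ,
      IsFiniteMeasure (s.map fun r => Measure.dirac (r / √d)).sum := by
    intro s
    induction s using Multiset.induction with
    | empty => simp only [Multiset.map_zero, Multiset.sum_zero]; infer_instance
    | cons a s ih => simp only [Multiset.map_cons, Multiset.sum_cons]; infer_instance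
  have := h G.matchingPoly.roots
  exact Measure.smul_finite _ (by simp)

/-- The matching measure, as a point of the space of finite measures on `ℝ` with the topology of
weak convergence. -/
noncomputable def matchingFiniteMeasure {V : Type*} [Fintype V] [Nonempty V]
    (G : SimpleGraph V) (d : ℝ) : FiniteMeasure ℝ :=
  ⟨G.matchingMeasure d, inferInstance⟩

end SimpleGraph

/-- The sequence of graphs `G n` with degree bounds `d n` is `α`-regular: the degree of a uniform
random vertex of `G n`, divided by `d n`, tends to `α` in probability. -/
def IsAsympRegular {V : ℕ → Type*} [∀ n, Fintype (V n)] (G : ∀ n, SimpleGraph (V n))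
    [∀ n, DecidableRel (G n).Adj] (d : ℕ → ℝ) (α : ℝ) : Prop :=
  ∀ ε : ℝ, 0 < ε →
    Tendsto (fun n => (Nat.card {v : V n // ε ≤ |((G n).degree v : ℝ) / d n - α|} : ℝ) /
      (Fintype.card (V n) : ℝ)) atTop (𝓝 0)

/-- `t(F, G n, d n)` converges for every finite tree `F`. -/
def TreeDensitiesConverge {V : ℕ → Type*} [∀ n, Fintype (V n)] (G : ∀ n, SimpleGraph (V n))
    (d : ℕ → ℝ) : Prop :=
  ∀ (k : ℕ) (F : SimpleGraph (Fin k)), F.IsTree →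
    ∃ t : ℝ, Tendsto (fun n => F.homDensity (G n) (d n)) atTop (𝓝 t)

/-- Wigner's semicircle density; `Real.sqrt` vanishes at negative reals, so this is zero outside
of `[-2, 2]`. -/
noncomputable def semicircleDensity (x : ℝ) : ℝ :=
  √(4 - x ^ 2) / (2 * Real.pi)

/-- The law of a random variable with Wigner's semicircle density. -/
noncomputable def wignerMeasure : Measure ℝ :=
  volume.withDensity fun x => ENNReal.ofReal (semicircleDensity x)

theorem continuous_semicircleDensity : Continuous semicircleDensity := by
  unfold semicircleDensity
  fun_prop

theorem semicircleDensity_nonneg (x : ℝ) : 0 ≤ semicircleDensity x := by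
  unfold semicircleDensity
  positivity

theorem semicircleDensity_eq_zero {x : ℝ} (hx : x ∉ Set.Ioc (-2 : ℝ) 2) :
    semicircleDensity x = 0 := by
  have h : 4 - x ^ 2 ≤ 0 := by
    by_contra! h
    exact hx ⟨by nlinarith, by nlinarith⟩
  simp [semicircleDensity, Real.sqrt_eq_zero_of_nonpos h]

theorem integral_semicircleDensity : ∫ x in (-2 : ℝ)..2, semicircleDensity x = 1 := by
  have h : ∀ x : ℝ, semicircleDensity x = Real.pi⁻¹ * √(1 - (x / 2) ^ 2) := by
    intro x
    have h4 : 4 - x ^ 2 = 2 ^ 2 * (1 - (x / 2) ^ 2) := by ring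
    unfold semicircleDensity
    rw [h4, Real.sqrt_mul (by positivity), Real.sqrt_sq (by norm_num)]
    field_simp
  simp only [h]
  rw [intervalIntegral.integral_const_mul,
    intervalIntegral.integral_comp_div (fun y => √(1 - y ^ 2)) (by norm_num : (2 : ℝ) ≠ 0)]
  have h1 : (-2 : ℝ) / 2 = -1 := by norm_num
  have h2 : (2 : ℝ) / 2 = 1 := by norm_num
  rw [h1, h2, integral_sqrt_one_sub_sq, smul_eq_mul]
  have := Real.pi_ne_zero
  field_simp

instance isProbabilityMeasure_wignerMeasure : IsProbabilityMeasure wignerMeasure := by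
  constructor
  have hint : ∫⁻ x in Set.Ioc (-2 : ℝ) 2, ENNReal.ofReal (semicircleDensity x) = 1 := by
    rw [← ofReal_integral_eq_lintegral_ofReal
      (continuous_semicircleDensity.integrableOn_Ioc)
      (Eventually.of_forall semicircleDensity_nonneg),
      ← intervalIntegral.integral_of_le (by norm_num), integral_semicircleDensity,
      ENNReal.ofReal_one]
  rw [wignerMeasure, withDensity_apply _ MeasurableSet.univ, Measure.restrict_univ, ← hint,
    ← lintegral_indicator measurableSet_Ioc]
  congr 1 with x
  by_cases hx : x ∈ Set.Ioc (-2 : ℝ) 2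
  · rw [Set.indicator_of_mem hx]
  · rw [Set.indicator_of_notMem hx, semicircleDensity_eq_zero hx, ENNReal.ofReal_zero]

/-- The semicircle distribution on `[-2 β, 2 β]`: the law of `β X`, where `X` has Wigner's
semicircle density (for `β = 0` this is the point mass at `0`). -/
noncomputable def semicircleLaw (β : ℝ) : ProbabilityMeasure ℝ :=
  ⟨wignerMeasure.map fun x => β * x,
    Measure.isProbabilityMeasure_map (measurable_const_mul β).aemeasurable⟩

/-- The integral of an extended-real function, as the integral of its positive part minus the
integral of its negative part. It is used below only where the positive part has a finite integral;
its value may then be `-∞`. -/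
noncomputable def extendedIntegral (μ : Measure ℝ) (f : ℝ → EReal) : EReal :=
  ((∫⁻ x, (f x).toENNReal ∂μ : ℝ≥0∞) : EReal) - ((∫⁻ x, (-f x).toENNReal ∂μ : ℝ≥0∞) : EReal)

/-- `log |x|` as an extended real number, equal to `-∞` at `x = 0`. -/
noncomputable def extendedLogAbs (x : ℝ) : EReal :=
  ENNReal.log (ENNReal.ofReal |x|)

/-! Three facts about the matching polynomial carry the theorem.

Real, bounded roots. Deleting a vertex `u` gives μ(S) = x μ(S∖u) − Σ_{v∼u} μ(S∖u∖v)
(`matchingSum_eq`). Read as a recursion for the ratios μ(S)/μ(S∖u), it keeps them in the upper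
half-plane when x is there, and at least √d when x ≥ 2√d. Hence the roots are real and lie in [−2√d,
2√d] (Heilmann and Lieb), and all ρ_n live on the compact interval [−2, 2], where convergence of
moments implies weak convergence.

Moments. By logarithmic differentiation the k-th power sum of the roots is the sum over u of the
coefficient of t^k in P(V,u) = Q(V∖u)/Q(V), where Q is the reversed matching polynomial
(`sum_pow_roots_matchingPoly`). These series satisfy P(S,u) = 1 + t² P(S,u) Σ_{v∼u} P(S∖u,v). After
division by √d^k the coefficients are bounded by the semicircle moments, and forbidding boundedly
many neighbours out of possibly d changes them by O(1/d). So the moments of ρ_n are, up to O(1/d_n),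
the averages of `branchCoeff`, which solves the same recursion without deletions. Unrolled, that
recursion is a fixed linear combination of normalized counts of rooted tree homomorphisms, so the
averages converge in (a). If most degrees are near αd, it is close in L¹ to its constant solution,
whose values are the semicircle moments times √α^k; this gives the limit in (b).

Counting matchings. |μ(G,i)| is the number of matchings, so log(𝕄^{2/v}/d) = ∫ log(1/d + x²)
dρ_{G,d}. For fixed ε > 0 this is eventually at most ∫ log(ε + x²) dρ_n, whose integrand is
continuous; let n → ∞ and then ε ↓ 0. Only an upper bound results, because log|x| is unbounded below
at 0. For the semicircle law on [−2, 2] the integral of log|x| is −1/2, which turns the bound into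
log α − 1, that is α/e. -/

namespace SimpleGraph

/-! ### Matching sums and the vertex-deletion recursion -/

section MatchingSum

variable {V : Type*} [Fintype V] (G : SimpleGraph V)

open scoped Classical in
/-- The matchings of `G` inside the vertex set `S`, as sets of edges. -/
noncomputable def matchingsIn (S : Finset V) : Finset (Finset (Sym2 V)) :=
  Finset.univ.filter fun M => (∀ e ∈ M, e ∈ G.edgeSet ∧ ∀ v ∈ e, v ∈ S) ∧
    ∀ e ∈ M, ∀ f ∈ M, ∀ v, v ∈ e → v ∈ f → e = f

variable {G}

theorem mem_matchingsIn {S : Finset V} {M : Finset (Sym2 V)} :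
    M ∈ G.matchingsIn S ↔ (∀ e ∈ M, e ∈ G.edgeSet ∧ ∀ v ∈ e, v ∈ S) ∧
      ∀ e ∈ M, ∀ f ∈ M, ∀ v, v ∈ e → v ∈ f → e = f := by
  simp [matchingsIn]

theorem matchingsIn_empty : G.matchingsIn ∅ = {∅} := by
  ext M
  rw [mem_matchingsIn, Finset.mem_singleton]
  constructor
  · rintro ⟨h, -⟩
    refine Finset.eq_empty_of_forall_notMem fun e he => ?_
    induction e using Sym2.ind with
    | _ a b => simpa using (h _ he).2 a
  · rintro rfl
    simp

variable (G) in
/-- The homogeneous matching polynomial `∑ M, x ^ (|S| - 2 |M|) y ^ |M|` of the subgraph of `G`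
induced by `S`. -/
noncomputable def matchingSum {A : Type*} [CommRing A] (x y : A) (S : Finset V) : A :=
  ∑ M ∈ G.matchingsIn S, x ^ (S.card - 2 * M.card) * y ^ M.card

variable {A : Type*} [CommRing A] (x y : A)

@[simp] theorem matchingSum_empty : G.matchingSum x y ∅ = 1 := by
  simp [matchingSum, matchingsIn_empty]

theorem map_matchingSum {B : Type*} [CommRing B] (f : A →+* B) (S : Finset V) :
    f (G.matchingSum x y S) = G.matchingSum (f x) (f y) S := by
  simp [matchingSum]

variable [DecidableEq V]

theorem notMem_of_mem_matchingsIn_erase {S : Finset V} {u : V} {M : Finset (Sym2 V)}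
    (hM : M ∈ G.matchingsIn (S.erase u)) {e : Sym2 V} (hu : u ∈ e) : e ∉ M := fun he => by
  simpa using ((mem_matchingsIn.1 hM).1 e he).2 u hu

variable [DecidableRel G.Adj]

theorem matchingsIn_eq_union {S : Finset V} {u : V} (hu : u ∈ S) :
    G.matchingsIn S = G.matchingsIn (S.erase u) ∪
      ((S.erase u).filter (G.Adj u)).biUnion fun v =>
        (G.matchingsIn ((S.erase u).erase v)).image (insert s(u, v)) := by
  ext M
  simp only [Finset.mem_union, Finset.mem_biUnion, Finset.mem_filter, Finset.mem_image]
  constructor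
  · intro hM
    by_cases h : ∃ e ∈ M, u ∈ e
    · right
      obtain ⟨e, he, hue⟩ := h
      obtain ⟨v, rfl⟩ := hue
      have hM' := mem_matchingsIn.1 hM
      have hadj : G.Adj u v := (hM'.1 _ he).1
      refine ⟨v, ⟨Finset.mem_erase.2 ⟨hadj.ne', (hM'.1 _ he).2 v (by simp)⟩, hadj⟩,
        M.erase s(u, v), ?_, Finset.insert_erase he⟩
      rw [mem_matchingsIn]
      refine ⟨fun f hf => ?_, fun f hf g hg =>
        hM'.2 f (Finset.mem_of_mem_erase hf) g (Finset.mem_of_mem_erase hg)⟩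
      obtain ⟨hne, hfM⟩ := Finset.mem_erase.1 hf
      refine ⟨(hM'.1 f hfM).1, fun w hw => ?_⟩
      rw [Finset.mem_erase, Finset.mem_erase]
      refine ⟨?_, ?_, (hM'.1 f hfM).2 w hw⟩
      · rintro rfl
        exact hne (hM'.2 f hfM _ he w hw (by simp))
      · rintro rfl
        exact hne (hM'.2 f hfM _ he w hw (by simp))
    · left
      push Not at h
      have hM' := mem_matchingsIn.1 hM
      rw [mem_matchingsIn]
      refine ⟨fun e he => ⟨(hM'.1 e he).1, fun w hw => ?_⟩, hM'.2⟩
      refine Finset.mem_erase.2 ⟨?_, (hM'.1 e he).2 w hw⟩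
      rintro rfl
      exact h e he hw
  · rintro (hM | ⟨v, ⟨hv, hadj⟩, M', hM', rfl⟩)
    · rw [mem_matchingsIn] at hM ⊢
      exact ⟨fun e he => ⟨(hM.1 e he).1, fun w hw => Finset.mem_of_mem_erase ((hM.1 e he).2 w hw)⟩,
        hM.2⟩
    · have h1 := mem_matchingsIn.1 hM'
      have key : ∀ f ∈ M', ∀ w, w ∈ s(u, v) → w ∉ f := by
        intro f hf w hw hwf
        have h2 := (h1.1 f hf).2 w hwf
        rw [Finset.mem_erase, Finset.mem_erase] at h2
        rcases Sym2.mem_iff.1 hw with rfl | rfl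
        · exact h2.2.1 rfl
        · exact h2.1 rfl
      rw [mem_matchingsIn]
      refine ⟨fun e he => ?_, fun e he f hf w hwe hwf => ?_⟩
      · rcases Finset.mem_insert.1 he with rfl | he
        · refine ⟨hadj, fun w hw => ?_⟩
          rcases Sym2.mem_iff.1 hw with rfl | rfl
          · exact hu
          · exact Finset.mem_of_mem_erase hv
        · exact ⟨(h1.1 e he).1, fun w hw =>
            Finset.mem_of_mem_erase (Finset.mem_of_mem_erase ((h1.1 e he).2 w hw))⟩
      · rcases Finset.mem_insert.1 he with rfl | he <;> rcases Finset.mem_insert.1 hf with rfl | hf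
        · rfl
        · exact (key f hf w hwe hwf).elim
        · exact (key e he w hwf hwe).elim
        · exact h1.2 e he f hf w hwe hwf

theorem two_mul_card_le_of_mem_matchingsIn {S : Finset V} {M : Finset (Sym2 V)}
    (hM : M ∈ G.matchingsIn S) : 2 * M.card ≤ S.card := by
  induction h : S.card using Nat.strong_induction_on generalizing S M with
  | _ n ih =>
    rcases S.eq_empty_or_nonempty with rfl | ⟨u, hu⟩
    · rw [matchingsIn_empty, Finset.mem_singleton] at hM
      simp [hM]
    · have h1 := Finset.card_erase_of_mem hu
      have h0 := Finset.card_pos.2 ⟨u, hu⟩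
      rw [matchingsIn_eq_union hu] at hM
      simp only [Finset.mem_union, Finset.mem_biUnion, Finset.mem_filter, Finset.mem_image] at hM
      obtain hM | ⟨v, ⟨hv, hadj⟩, M', hM', rfl⟩ := hM
      · have := ih _ (by omega) hM rfl
        omega
      · have h2 := Finset.card_erase_of_mem hv
        have h3 := Finset.card_pos.2 ⟨v, hv⟩
        have := ih _ (by omega) hM' rfl
        have := Finset.card_insert_le s(u, v) M'
        omega

/-- Split the matchings by whether `u` is uncovered or matched to some `v`. The bound `2 * M.card ≤
S.card` makes the truncated subtraction in the exponents harmless. -/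
theorem matchingSum_eq {S : Finset V} {u : V} (hu : u ∈ S) :
    G.matchingSum x y S = x * G.matchingSum x y (S.erase u) +
      y * ∑ v ∈ (S.erase u).filter (G.Adj u), G.matchingSum x y ((S.erase u).erase v) := by
  have hS := Finset.card_erase_of_mem hu
  have hS' := Finset.card_pos.2 ⟨u, hu⟩
  have hnot : ∀ v, ∀ M ∈ G.matchingsIn ((S.erase u).erase v), s(u, v) ∉ M := fun v M hM =>
    notMem_of_mem_matchingsIn_erase hM (by simp)
  rw [matchingSum, matchingsIn_eq_union hu, Finset.sum_union, Finset.sum_biUnion]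
  · congr 1
    · rw [matchingSum, Finset.mul_sum]
      refine Finset.sum_congr rfl fun M hM => ?_
      have := two_mul_card_le_of_mem_matchingsIn hM
      rw [show S.card - 2 * M.card = ((S.erase u).card - 2 * M.card) + 1 by omega]
      ring
    · rw [Finset.mul_sum]
      refine Finset.sum_congr rfl fun v hv => ?_
      obtain ⟨hv, -⟩ := Finset.mem_filter.1 hv
      have h2 := Finset.card_erase_of_mem hv
      have h3 := Finset.card_pos.2 ⟨v, hv⟩
      rw [Finset.sum_image, matchingSum, Finset.mul_sum]
      · refine Finset.sum_congr rfl fun M hM => ?_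
        rw [Finset.card_insert_of_notMem (hnot v M hM),
          show S.card - 2 * (M.card + 1) = ((S.erase u).erase v).card - 2 * M.card by omega]
        ring
      · intro M hM M' hM' h
        have := congrArg (fun N => N.erase s(u, v)) h
        simpa [Finset.erase_insert (hnot v M hM), Finset.erase_insert (hnot v M' hM')] using this
  · intro v hv w hw hvw
    rw [Function.onFun, Finset.disjoint_left]
    intro N hN hN'
    obtain ⟨M, hM, rfl⟩ := Finset.mem_image.1 hN
    obtain ⟨M', hM', h⟩ := Finset.mem_image.1 hN'
    have h1 : s(u, v) ∈ insert s(u, w) M' := h ▸ Finset.mem_insert_self _ _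
    rcases Finset.mem_insert.1 h1 with h1 | h1
    · rcases Sym2.eq_iff.1 h1 with h2 | h2
      · exact hvw h2.2
      · exact hvw (h2.2.trans h2.1)
    -- The two erasures are swapped so that `u` is the last vertex removed: no edge of `M'` can then
    -- meet `u`.
    · refine notMem_of_mem_matchingsIn_erase (G := G) (e := s(u, v)) (u := u) (S := S.erase w)
        (M := M') ?_ (by simp) h1
      rwa [Finset.erase_right_comm]
  · rw [Finset.disjoint_left]
    intro M hM hM'
    simp only [Finset.mem_biUnion, Finset.mem_image] at hM'
    obtain ⟨v, -, M', -, rfl⟩ := hM'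
    exact notMem_of_mem_matchingsIn_erase hM (e := s(u, v)) (by simp) (Finset.mem_insert_self _ _)

end MatchingSum

/-- Homogeneity with weight 1 for `x` and 2 for `y`. It serves three times: for the parity of the
polynomial, for its value at i, and for its reversal. -/
theorem matchingSum_mul {V : Type*} [Fintype V] {G : SimpleGraph V} {A : Type*} [CommRing A]
    (x y c : A) (S : Finset V) :
    G.matchingSum (c * x) (c ^ 2 * y) S = c ^ S.card * G.matchingSum x y S := by
  classical
  rw [matchingSum, matchingSum, Finset.mul_sum]
  refine Finset.sum_congr rfl fun M hM => ?_
  have := two_mul_card_le_of_mem_matchingsIn hM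
  rw [mul_pow, mul_pow, ← pow_mul]
  obtain ⟨k, hk⟩ := Nat.exists_eq_add_of_le this
  rw [hk]
  simp only [Nat.add_sub_cancel_left]
  ring

section NumMatchings

variable {V : Type*} [Fintype V] (G : SimpleGraph V)

theorem numMatchings_eq_card (k : ℕ) :
    G.numMatchings k = ((G.matchingsIn Finset.univ).filter fun M => M.card = k).card := by
  classical
  rw [numMatchings, ← Fintype.card_coe, ← Nat.card_eq_fintype_card]
  have hmem : ∀ (H : G.Subgraph) (e : Sym2 V), e ∈ H.edgeSet.toFinset ↔ e ∈ H.edgeSet := by simp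
  refine Nat.card_eq_of_bijective
    (fun H => ⟨H.1.edgeSet.toFinset, Finset.mem_filter.2 ⟨mem_matchingsIn.2 ⟨?_, ?_⟩, ?_⟩⟩) ⟨?_, ?_⟩
  · intro e he
    exact ⟨H.1.edgeSet_subset ((hmem _ _).1 he), by simp⟩
  · rintro _ he _ hf v ⟨a, rfl⟩ ⟨b, rfl⟩
    rw [hmem, Subgraph.mem_edgeSet] at he hf
    rw [(H.2.1 (H.1.edge_vert he)).unique he hf]
  · rw [← Set.ncard_eq_toFinset_card', H.2.2]
  · rintro ⟨H, hH, hk⟩ ⟨H', hH', hk'⟩ h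
    have h1 : H.edgeSet = H'.edgeSet := by
      simpa using h
    have hadj : ∀ a b, H.Adj a b ↔ H'.Adj a b := fun a b => by
      rw [← Subgraph.mem_edgeSet, h1, Subgraph.mem_edgeSet]
    rw [Subtype.mk.injEq]
    ext a b
    -- A subgraph may have isolated vertices, but a matching has none, so its edges determine its
    -- vertices.
    · rw [← hH.support_eq_verts, ← hH'.support_eq_verts, Subgraph.mem_support, Subgraph.mem_support]
      simp [hadj]
    · exact hadj a b
  · rintro ⟨M, hM⟩
    obtain ⟨hM, hcard⟩ := Finset.mem_filter.1 hM
    rw [mem_matchingsIn] at hM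
    let H : G.Subgraph :=
      { verts := {v | ∃ e ∈ M, v ∈ e}
        Adj := fun a b => s(a, b) ∈ M
        adj_sub := fun h => (hM.1 _ h).1
        edge_vert := fun h => ⟨_, h, by simp⟩
        symm := ⟨fun a b h => by rwa [Sym2.eq_swap]⟩ }
    have hH : H.edgeSet.toFinset = M := by
      ext e
      induction e using Sym2.ind with
      | _ a b => simp [H]
    refine ⟨⟨H, ?_, ?_⟩, Subtype.ext hH⟩
    · rintro v ⟨e, he, w, rfl⟩
      refine ⟨w, he, fun z hz => ?_⟩
      exact Sym2.congr_right.1 (hM.2 _ hz _ he v (by simp) (by simp))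
    · rw [Set.ncard_eq_toFinset_card', hH, hcard]

theorem card_mem_range_of_mem_matchingsIn {M : Finset (Sym2 V)}
    (hM : M ∈ G.matchingsIn Finset.univ) :
    M.card ∈ Finset.range (Fintype.card V / 2 + 1) := by
  classical
  have := two_mul_card_le_of_mem_matchingsIn hM
  rw [Finset.card_univ] at this
  rw [Finset.mem_range]
  omega

theorem matchingPoly_eq_matchingSum :
    G.matchingPoly = G.matchingSum Polynomial.X (-1) Finset.univ := by
  rw [matchingSum, matchingPoly, ← Finset.sum_fiberwise_of_maps_to
    fun M => G.card_mem_range_of_mem_matchingsIn]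
  refine Finset.sum_congr rfl fun k _ => ?_
  rw [numMatchings_eq_card, Finset.sum_congr rfl (g := fun _ => Polynomial.C ((-1 : ℝ) ^ k) *
    Polynomial.X ^ (Fintype.card V - 2 * k)), Finset.sum_const, nsmul_eq_mul]
  · simp only [map_mul, map_natCast]
    ring
  · intro M hM
    rw [(Finset.mem_filter.1 hM).2, Finset.card_univ]
    simp [mul_comm]

theorem totalMatchings_eq_matchingSum {A : Type*} [CommRing A] :
    (G.totalMatchings : A) = G.matchingSum 1 1 Finset.univ := by
  rw [matchingSum, totalMatchings,
    ← Finset.sum_fiberwise_of_maps_to fun M => G.card_mem_range_of_mem_matchingsIn, Nat.cast_sum]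
  refine Finset.sum_congr rfl fun k _ => ?_
  simp [numMatchings_eq_card]

end NumMatchings

end SimpleGraph

/-! ### Real-rootedness, root bounds and the value at i -/

namespace SimpleGraph

section Roots

variable {V : Type*} [Fintype V] (G : SimpleGraph V)

/-- The ratio equals z minus a sum of reciprocals of ratios for `S.erase u`. By induction these lie
in the upper half-plane, so their reciprocals lie in the lower one, and subtracting them only raises
the imaginary part. -/
theorem matchingSum_ne_zero_and_im_pos [DecidableEq V] {z : ℂ} (hz : 0 < z.im) (S : Finset V) :
    G.matchingSum z (-1) S ≠ 0 ∧
      ∀ u ∈ S, 0 < (G.matchingSum z (-1) S / G.matchingSum z (-1) (S.erase u)).im := by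
  classical
  induction S using Finset.strongInduction with
  | H S ih =>
    have key : ∀ u ∈ S, 0 < (G.matchingSum z (-1) S / G.matchingSum z (-1) (S.erase u)).im := by
      intro u hu
      obtain ⟨h0, him⟩ := ih _ (Finset.erase_ssubset hu)
      rw [matchingSum_eq z (-1) hu, neg_one_mul, ← sub_eq_add_neg, sub_div,
        mul_div_cancel_right₀ _ h0, Finset.sum_div, Complex.sub_im, Complex.im_sum]
      have : ∑ v ∈ (S.erase u).filter (G.Adj u),
          (G.matchingSum z (-1) ((S.erase u).erase v) / G.matchingSum z (-1) (S.erase u)).im ≤ 0 := by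
        refine Finset.sum_nonpos fun v hv => ?_
        rw [← inv_div, Complex.inv_im]
        have := him v (Finset.mem_filter.1 hv).1
        exact div_nonpos_of_nonpos_of_nonneg (by linarith) (Complex.normSq_nonneg _)
      linarith
    refine ⟨?_, key⟩
    rcases S.eq_empty_or_nonempty with rfl | ⟨u, hu⟩
    · simp
    · intro h
      simpa [h] using key u hu

/-- The threshold 2√d is what closes the induction: at most d neighbours, each contributing at most
1/√d to the ratio, leave at least 2√d − d/√d = √d. -/
theorem matchingSum_pos_of_two_mul_sqrt_le [DecidableEq V] [DecidableRel G.Adj] {d x : ℝ}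
    (hd : G.IsAdmissible d) (hx : 2 * √d ≤ x) (S : Finset V) :
    0 < G.matchingSum x (-1) S ∧
      ∀ u ∈ S, √d * G.matchingSum x (-1) (S.erase u) ≤ G.matchingSum x (-1) S := by
  have hd0 : 0 < d := by linarith [hd.1]
  have hs : 0 < √d := Real.sqrt_pos.2 hd0
  induction S using Finset.strongInduction with
  | H S ih =>
    have key : ∀ u ∈ S, √d * G.matchingSum x (-1) (S.erase u) ≤ G.matchingSum x (-1) S := by
      intro u hu
      obtain ⟨h0, hle⟩ := ih _ (Finset.erase_ssubset hu)
      rw [matchingSum_eq x (-1) hu]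
      have h1 : ∑ v ∈ (S.erase u).filter (G.Adj u), G.matchingSum x (-1) ((S.erase u).erase v) ≤
          √d * G.matchingSum x (-1) (S.erase u) := by
        calc _ ≤ ∑ v ∈ (S.erase u).filter (G.Adj u), (G.matchingSum x (-1) (S.erase u) / √d) := by
              refine Finset.sum_le_sum fun v hv => ?_
              rw [le_div_iff₀ hs, mul_comm]
              exact hle v (Finset.mem_filter.1 hv).1
          _ ≤ d * (G.matchingSum x (-1) (S.erase u) / √d) := by
              rw [Finset.sum_const, nsmul_eq_mul]
              gcongr
              refine le_trans ?_ (hd.2 u)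
              rw [← card_neighborFinset_eq_degree]
              exact_mod_cast Finset.card_le_card fun v hv => by
                simpa using (Finset.mem_filter.1 hv).2
          _ = _ := by
              nth_rewrite 1 [← Real.mul_self_sqrt hd0.le]
              field_simp
      nlinarith
    refine ⟨?_, key⟩
    rcases S.eq_empty_or_nonempty with rfl | ⟨u, hu⟩
    · simp
    · exact (mul_pos hs (ih _ (Finset.erase_ssubset hu)).1).trans_le (key u hu)

theorem matchingPoly_monic_and_natDegree :
    G.matchingPoly.Monic ∧ G.matchingPoly.natDegree = Fintype.card V := by
  classical
  have h0 : (∅ : Finset (Sym2 V)) ∈ G.matchingsIn Finset.univ := by simp [mem_matchingsIn]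
  have h : (∑ M ∈ (G.matchingsIn Finset.univ).erase ∅,
      (Polynomial.X : ℝ[X]) ^ (Finset.card (Finset.univ : Finset V) - 2 * M.card) * (-1) ^ M.card) ∈
      Polynomial.degreeLT ℝ (Fintype.card V) := by
    refine Submodule.sum_mem _ fun M hM => ?_
    obtain ⟨hne, hM⟩ := Finset.mem_erase.1 hM
    have h2 := two_mul_card_le_of_mem_matchingsIn hM
    have h1 := Finset.card_pos.2 (Finset.nonempty_iff_ne_empty.2 hne)
    rw [Finset.card_univ] at h2
    rw [Polynomial.mem_degreeLT, Finset.card_univ,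
      show ((-1 : ℝ[X]) ^ M.card) = Polynomial.C ((-1 : ℝ) ^ M.card) by simp]
    refine (Polynomial.degree_mul_C_of_isUnit (by simp) _).le.trans_lt ?_
    rw [Polynomial.degree_X_pow]
    exact_mod_cast (by omega)
  rw [Polynomial.mem_degreeLT] at h
  rw [matchingPoly_eq_matchingSum, matchingSum, ← Finset.add_sum_erase _ _ h0]
  simp only [Finset.card_empty, mul_zero, Nat.sub_zero, pow_zero, mul_one]
  rw [Finset.card_univ] at h ⊢
  exact ⟨Polynomial.monic_X_pow_add h, 
    Polynomial.natDegree_eq_of_degree_eq_some (by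
      rw [Polynomial.degree_add_eq_left_of_degree_lt (by rwa [Polynomial.degree_X_pow]),
        Polynomial.degree_X_pow])⟩

theorem eval₂_matchingPoly {A : Type*} [CommRing A] (f : ℝ →+* A) (x : A) :
    G.matchingPoly.eval₂ f x = G.matchingSum x (-1) Finset.univ := by
  rw [matchingPoly_eq_matchingSum, ← Polynomial.coe_eval₂RingHom, map_matchingSum]
  simp

theorem eval_matchingPoly (x : ℝ) :
    G.matchingPoly.eval x = G.matchingSum x (-1) Finset.univ :=
  G.eval₂_matchingPoly (RingHom.id ℝ) x

theorem matchingSum_neg {A : Type*} [CommRing A] (x y : A) (S : Finset V) :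
    G.matchingSum (-x) y S = (-1) ^ S.card * G.matchingSum x y S := by
  rw [← matchingSum_mul]
  simp

theorem matchingPoly_splits : G.matchingPoly.Splits := by
  classical
  refine Polynomial.Splits.of_splits_map Complex.ofRealHom (IsAlgClosed.splits _) fun z hz => ?_
  have h0 : G.matchingSum z (-1) Finset.univ = 0 := by
    rw [← eval₂_matchingPoly G Complex.ofRealHom, ← Polynomial.eval_map]
    exact Polynomial.isRoot_of_mem_roots hz
  have him : z.im = 0 := by
    rcases lt_trichotomy z.im 0 with h | h | h
    -- The polynomial is even or odd, so a root in the lower half-plane would give the root `-z` in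
    -- the upper one.
    · exact absurd (by rw [matchingSum_neg, h0, mul_zero])
        (G.matchingSum_ne_zero_and_im_pos (z := -z) (by simpa using h) Finset.univ).1
    · exact h
    · exact absurd h0 (G.matchingSum_ne_zero_and_im_pos h Finset.univ).1
  exact ⟨z.re, Complex.ext (by simp) (by simp [him])⟩

theorem card_roots_matchingPoly : G.matchingPoly.roots.card = Fintype.card V := by
  rw [← G.matchingPoly_splits.natDegree_eq_card_roots, G.matchingPoly_monic_and_natDegree.2]

theorem abs_le_of_mem_roots_matchingPoly [DecidableRel G.Adj] {d : ℝ} (hd : G.IsAdmissible d)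
    {r : ℝ} (hr : r ∈ G.matchingPoly.roots) : |r| ≤ 2 * √d := by
  classical
  by_contra! h
  have h0 : G.matchingSum r (-1) Finset.univ = 0 := by
    rw [← eval_matchingPoly]
    exact Polynomial.isRoot_of_mem_roots hr
  have h1 := (G.matchingSum_pos_of_two_mul_sqrt_le hd h.le Finset.univ).1
  rcases abs_choice r with hr' | hr' <;> rw [hr'] at h1
  · exact h1.ne' h0
  · rw [matchingSum_neg, h0, mul_zero] at h1
    exact h1.false

theorem matchingSum_eq_prod_roots {A : Type*} [CommRing A] [Algebra ℝ A] (x : A) :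
    G.matchingSum x (-1) Finset.univ =
      (G.matchingPoly.roots.map fun r => x - algebraMap ℝ A r).prod := by
  rw [← eval₂_matchingPoly G (algebraMap ℝ A)]
  conv_lhs => rw [G.matchingPoly_splits.eq_prod_roots_of_monic G.matchingPoly_monic_and_natDegree.1]
  rw [Polynomial.eval₂_multiset_prod, Multiset.map_map]
  simp

/-- At x = i all signs align: a matching with k edges contributes (−1)^k i^(v−2k) = i^v. Taking
squared absolute values of the factors i − r gives 1 + r². -/
theorem totalMatchings_sq :
    (G.totalMatchings : ℝ) ^ 2 = (G.matchingPoly.roots.map fun r => 1 + r ^ 2).prod := by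
  have h : Complex.I ^ (Finset.univ : Finset V).card * (G.totalMatchings : ℂ) =
      (G.matchingPoly.roots.map fun r => Complex.I - algebraMap ℝ ℂ r).prod := by
    rw [← matchingSum_eq_prod_roots, totalMatchings_eq_matchingSum, ← matchingSum_mul]
    simp
  have h2 := congrArg Complex.normSq h
  rw [map_mul, map_pow, map_multiset_prod, Multiset.map_map] at h2
  simp only [Complex.normSq_I, one_pow, one_mul, Complex.normSq_natCast] at h2
  rw [sq, h2]
  congr 2
  ext r
  simp [Complex.normSq_apply]
  ring

end Roots

end SimpleGraph

/-! ### Power sums of the roots as coefficients of path series -/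

open PowerSeries in
-- Logarithmic derivative of Q = ∏(1 − rt), cleared of denominators: −tQ'/Q = Σ rt/(1 − rt) = Σ
-- (1/(1 − rt) − 1).
theorem PowerSeries.prod_one_sub_mul_sum_mk (s : Multiset ℝ) :
    (s.map fun r => (1 - C r * X : PowerSeries ℝ)).prod *
        (s.map fun r => PowerSeries.mk fun k => r ^ k).sum =
      (s.card : PowerSeries ℝ) * (s.map fun r => (1 - C r * X : PowerSeries ℝ)).prod -
        X * PowerSeries.derivative ℝ (s.map fun r => (1 - C r * X : PowerSeries ℝ)).prod := by
  induction s using Multiset.induction with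
  | empty => simp
  | cons r s ih =>
    have h : (1 - C r * X : PowerSeries ℝ) * mk (fun k => r ^ k) = 1 := by
      ext k
      rw [sub_mul, one_mul, map_sub, mul_assoc, coeff_C_mul]
      rcases k with _ | k
      · simp
      · simp [coeff_succ_X_mul, coeff_one, pow_succ']
    simp only [Multiset.map_cons, Multiset.prod_cons, Multiset.sum_cons, Multiset.card_cons]
    rw [Derivation.leibniz, map_sub, Derivation.leibniz]
    simp only [smul_eq_mul, derivative_X, derivative_C, Derivation.map_one_eq_zero]
    push_cast
    linear_combination (1 - C r * X) * ih +
      (s.map fun r => (1 - C r * X : PowerSeries ℝ)).prod * h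

namespace SimpleGraph

section PowerSums

variable {V : Type*} [Fintype V] (G : SimpleGraph V)

/-- A matching with k edges survives the deletion of exactly the |S| − 2k vertices it leaves
uncovered, and `D` multiplies y^k by 2k. With D = t d/dt and y = −t² the right side becomes that of
`PowerSeries.prod_one_sub_mul_sum_mk`. -/
theorem sum_matchingSum_erase [DecidableEq V] {R A : Type*} [CommRing R] [CommRing A]
    [Algebra R A] (D : Derivation R A A)
    {y : A} (hy : D y = 2 * y) (S : Finset V) :
    ∑ w ∈ S, G.matchingSum 1 y (S.erase w) =
      S.card * G.matchingSum 1 y S - D (G.matchingSum 1 y S) := by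
  classical
  induction S using Finset.strongInduction with
  | H S ih =>
    rcases S.eq_empty_or_nonempty with rfl | ⟨u, hu⟩
    · simp
    set T := S.erase u with hT
    have hTS : T ⊂ S := Finset.erase_ssubset hu
    have hcard : (S.card : A) = T.card + 1 := by
      rw [← Finset.card_erase_add_one hu]
      push_cast
      rfl
    have h1 : ∀ w ∈ T, G.matchingSum 1 y (S.erase w) = G.matchingSum 1 y (T.erase w) +
        y * ∑ v ∈ (T.erase w).filter (G.Adj u), G.matchingSum 1 y ((T.erase v).erase w) := by
      intro w hw
      rw [matchingSum_eq 1 y (u := u) (Finset.mem_erase.2 ⟨(Finset.ne_of_mem_erase hw).symm, hu⟩),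
        one_mul, Finset.erase_right_comm (s := S)]
      simp only [Finset.erase_right_comm (a := w)]
      rfl
    have h2 : ∑ w ∈ T, ∑ v ∈ (T.erase w).filter (G.Adj u), G.matchingSum 1 y ((T.erase v).erase w) =
        ∑ v ∈ T.filter (G.Adj u), ((T.card - 1) * G.matchingSum 1 y (T.erase v) -
          D (G.matchingSum 1 y (T.erase v))) := by
      rw [Finset.sum_comm' (t' := T.filter (G.Adj u)) (s' := fun v => T.erase v)]
      · refine Finset.sum_congr rfl fun v hv => ?_
        have hv := (Finset.mem_filter.1 hv).1
        rw [ih _ ((Finset.erase_subset _ _).trans_ssubset hTS)]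
        rw [← Finset.card_erase_add_one hv]
        push_cast
        ring
      · intro w v
        simp only [Finset.mem_filter, Finset.mem_erase]
        tauto
    rw [← Finset.add_sum_erase _ _ hu, Finset.sum_congr rfl h1, Finset.sum_add_distrib, ih T hTS,
      ← Finset.mul_sum, h2, matchingSum_eq 1 y hu, Finset.sum_sub_distrib, ← Finset.mul_sum,
      one_mul, map_add, D.leibniz, map_sum, hy, hcard]
    simp only [smul_eq_mul]
    ring

theorem matchingSum_one_neg_X_sq_eq_prod :
    G.matchingSum (1 : PowerSeries ℝ) (-PowerSeries.X ^ 2) Finset.univ =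
      (G.matchingPoly.roots.map fun r => 1 - PowerSeries.C r * PowerSeries.X).prod := by
  have h : G.matchingSum (1 : ℝ[X]) (-Polynomial.X ^ 2) Finset.univ =
      (G.matchingPoly.roots.map fun r => 1 - Polynomial.C r * Polynomial.X).prod := by
    -- Both sides are t^v μ(1/t), which makes sense at every t ≠ 0; that is enough points to
    -- identify polynomials.
    refine Polynomial.eq_of_infinite_eval_eq _ _
      ((Set.finite_singleton (0 : ℝ)).infinite_compl.mono fun t ht => ?_)
    have ht : t ≠ 0 := ht
    rw [Set.mem_ofPred_eq, Polynomial.eval_multiset_prod, Multiset.map_map,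
      ← Polynomial.coe_evalRingHom, map_matchingSum]
    have h1 := G.matchingSum_mul (t⁻¹) (-1) t Finset.univ
    have h2 : t ^ G.matchingPoly.roots.card * (G.matchingPoly.roots.map fun r => t⁻¹ - r).prod =
        (G.matchingPoly.roots.map fun r => t * (t⁻¹ - r)).prod := by
      rw [Multiset.prod_map_mul, Multiset.map_const', Multiset.prod_replicate]
    rw [mul_inv_cancel₀ ht, matchingSum_eq_prod_roots, Finset.card_univ,
      ← G.card_roots_matchingPoly] at h1
    rw [Algebra.algebraMap_self] at h1
    simp only [RingHom.id_apply] at h1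
    rw [h2] at h1
    simp only [map_one, map_neg, map_pow, Polynomial.coe_evalRingHom, Polynomial.eval_X]
    rw [show -t ^ 2 = t ^ 2 * -1 by ring, h1]
    congr 1
    refine Multiset.map_congr rfl fun r _ => ?_
    simp
    field_simp
  have h2 := congrArg (Polynomial.coeToPowerSeries.ringHom (R := ℝ)) h
  rw [map_matchingSum, map_multiset_prod, Multiset.map_map] at h2
  simpa [Function.comp_def] using h2

/-- The power series `Q(S \ {u}) / Q(S)` where `Q(S)` is the reversed matching polynomial of the
subgraph induced by `S`. -/
noncomputable def pathSeries [DecidableEq V] (S : Finset V) (u : V) : PowerSeries ℝ :=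
  G.matchingSum 1 (-PowerSeries.X ^ 2) (S.erase u) * (G.matchingSum 1 (-PowerSeries.X ^ 2) S)⁻¹

theorem constantCoeff_matchingSum (S : Finset V) :
    PowerSeries.constantCoeff (G.matchingSum (1 : PowerSeries ℝ) (-PowerSeries.X ^ 2) S) = 1 := by
  rw [map_matchingSum, matchingSum, Finset.sum_eq_single ∅]
  · simp
  · intro M _ hM
    simp [hM]
  · intro h
    exact (h (by simp [mem_matchingsIn])).elim

theorem matchingSum_mul_inv (S : Finset V) :
    G.matchingSum (1 : PowerSeries ℝ) (-PowerSeries.X ^ 2) S *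
      (G.matchingSum (1 : PowerSeries ℝ) (-PowerSeries.X ^ 2) S)⁻¹ = 1 :=
  PowerSeries.mul_inv_cancel _ (by rw [constantCoeff_matchingSum]; exact one_ne_zero)

/-- The vertex recursion divided by Q(S), with Q(S∖u∖v)/Q(S) factored through Q(S∖u). It is the
first-return decomposition of closed walks in Godsil's path tree. -/
theorem pathSeries_eq [DecidableEq V] [DecidableRel G.Adj] {S : Finset V} {u : V} (hu : u ∈ S) :
    G.pathSeries S u = 1 + PowerSeries.X ^ 2 * (G.pathSeries S u *
      ∑ v ∈ (S.erase u).filter (G.Adj u), G.pathSeries (S.erase u) v) := by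
  simp only [pathSeries]
  rw [← Finset.sum_mul]
  have h1 := G.matchingSum_mul_inv S
  have h2 := G.matchingSum_mul_inv (S.erase u)
  have h3 := matchingSum_eq (G := G) (1 : PowerSeries ℝ) (-PowerSeries.X ^ 2) hu
  set Q := G.matchingSum (1 : PowerSeries ℝ) (-PowerSeries.X ^ 2) S
  set Q' := G.matchingSum (1 : PowerSeries ℝ) (-PowerSeries.X ^ 2) (S.erase u)
  linear_combination (-1 : PowerSeries ℝ) * Q⁻¹ * h3 + h1 - PowerSeries.X ^ 2 * Q⁻¹ *
    (∑ v ∈ (S.erase u).filter (G.Adj u),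
      G.matchingSum (1 : PowerSeries ℝ) (-PowerSeries.X ^ 2) ((S.erase u).erase v)) * h2

theorem coeff_zero_pathSeries [DecidableEq V] {S : Finset V} {u : V} (hu : u ∈ S) :
    PowerSeries.coeff 0 (G.pathSeries S u) = 1 := by
  classical
  rw [pathSeries_eq G hu]
  simp

theorem coeff_one_pathSeries [DecidableEq V] {S : Finset V} {u : V} (hu : u ∈ S) :
    PowerSeries.coeff 1 (G.pathSeries S u) = 0 := by
  classical
  rw [pathSeries_eq G hu]
  simp [PowerSeries.coeff_X_pow_mul', PowerSeries.coeff_one]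

theorem coeff_add_two_pathSeries [DecidableEq V] [DecidableRel G.Adj] {S : Finset V} {u : V}
    (hu : u ∈ S) (k : ℕ) :
    PowerSeries.coeff (k + 2) (G.pathSeries S u) =
      ∑ p ∈ Finset.HasAntidiagonal.antidiagonal k, PowerSeries.coeff p.1 (G.pathSeries S u) *
        ∑ v ∈ (S.erase u).filter (G.Adj u), PowerSeries.coeff p.2 (G.pathSeries (S.erase u) v) := by
  conv_lhs => rw [pathSeries_eq G hu]
  rw [map_add, PowerSeries.coeff_X_pow_mul, PowerSeries.coeff_mul, PowerSeries.coeff_one]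
  simp

/-- The generating series of the power sums times Q, and the sum of all Q(V∖u), both equal vQ − tQ';
divide by Q. -/
theorem sum_pow_roots_matchingPoly [DecidableEq V] (k : ℕ) :
    (G.matchingPoly.roots.map fun r => r ^ k).sum =
      ∑ u, PowerSeries.coeff k (G.pathSeries Finset.univ u) := by
  have h1 := PowerSeries.prod_one_sub_mul_sum_mk G.matchingPoly.roots
  have h2 := G.sum_matchingSum_erase
    ((PowerSeries.X : PowerSeries ℝ) • PowerSeries.derivative ℝ)
    (y := -PowerSeries.X ^ 2) (by
      simp [Derivation.leibniz_pow, PowerSeries.derivative_X]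
      ring) Finset.univ
  rw [← matchingSum_one_neg_X_sq_eq_prod, card_roots_matchingPoly] at h1
  rw [Finset.card_univ] at h2
  simp only [Derivation.smul_apply, smul_eq_mul] at h2
  rw [← h1] at h2
  have h3 : ∑ u, G.pathSeries Finset.univ u =
      (G.matchingPoly.roots.map fun r => PowerSeries.mk fun k => r ^ k).sum := by
    simp only [pathSeries]
    rw [← Finset.sum_mul, h2, mul_right_comm, matchingSum_mul_inv, one_mul]
  rw [← map_sum, h3, map_multiset_sum, Multiset.map_map]
  simp

end PowerSums

end SimpleGraph

/-- The moments of the semicircle distribution: Catalan numbers in the even places, zero in the odd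
ones. -/
noncomputable def semicircleMoment : ℕ → ℝ
  | 0 => 1
  | 1 => 0
  | k + 2 => ∑ i : Fin (k + 1), semicircleMoment i * semicircleMoment (k - i)

theorem semicircleMoment_nonneg (k : ℕ) : 0 ≤ semicircleMoment k := by
  induction k using Nat.strong_induction_on with
  | _ k ih =>
    match k with
    | 0 => simp [semicircleMoment]
    | 1 => simp [semicircleMoment]
    | k + 2 =>
      rw [semicircleMoment]
      exact Finset.sum_nonneg fun i _ => mul_nonneg (ih _ (by omega)) (ih _ (by omega))

/-! ### Path series without deletions, up to an error O(1/d) -/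

namespace SimpleGraph

section BranchCoeff

/-- The normalized number of closed walks of length `k` from the root that have a tree-like
shape: the coefficients of the solution of `B u = 1 + t² B u (∑ v ~ u, B v) / d`. -/
noncomputable def branchCoeff {V : Type*} [Fintype V] (G : SimpleGraph V) [DecidableRel G.Adj]
    (d : ℝ) : ℕ → V → ℝ
  | 0, _ => 1
  | 1, _ => 0
  | k + 2, u => ∑ i : Fin (k + 1), G.branchCoeff d i u *
      ((∑ v ∈ Finset.univ.filter (G.Adj u), G.branchCoeff d (k - i) v) / d)

variable {V : Type*} [Fintype V] {G : SimpleGraph V} [DecidableRel G.Adj] {d : ℝ}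

theorem IsAdmissible.pos (hd : G.IsAdmissible d) : 0 < d := zero_lt_one.trans_le hd.1

theorem IsAdmissible.card_filter_le (hd : G.IsAdmissible d) (u : V) :
    ((Finset.univ.filter (G.Adj u)).card : ℝ) ≤ d := by
  refine le_trans (le_of_eq ?_) (hd.2 u)
  rw [← card_neighborFinset_eq_degree, neighborFinset_eq_filter]

theorem IsAdmissible.sum_div_mem_Icc (hd : G.IsAdmissible d) {u : V} {T : Finset V}
    (hT : T ⊆ Finset.univ.filter (G.Adj u)) {f : V → ℝ} {B : ℝ}
    (hf : ∀ v ∈ T, 0 ≤ f v ∧ f v ≤ B) (hB : 0 ≤ B) :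
    0 ≤ (∑ v ∈ T, f v) / d ∧ (∑ v ∈ T, f v) / d ≤ B := by
  refine ⟨div_nonneg (Finset.sum_nonneg fun v hv => (hf v hv).1) hd.pos.le, ?_⟩
  rw [div_le_iff₀ hd.pos]
  calc ∑ v ∈ T, f v ≤ ∑ v ∈ T, B := Finset.sum_le_sum fun v hv => (hf v hv).2
    _ = T.card * B := by simp
    _ ≤ d * B := by
      gcongr
      exact le_trans (by exact_mod_cast Finset.card_le_card hT) (hd.card_filter_le u)
    _ = B * d := mul_comm _ _

/-- At most d neighbours are summed and the sum is divided by d, so the recursion is dominated by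
that of `semicircleMoment`. -/
theorem IsAdmissible.branchCoeff_mem_Icc (hd : G.IsAdmissible d) (k : ℕ) (u : V) :
    0 ≤ G.branchCoeff d k u ∧ G.branchCoeff d k u ≤ semicircleMoment k := by
  induction k using Nat.strong_induction_on generalizing u with
  | _ k ih =>
    match k with
    | 0 => simp [semicircleMoment, branchCoeff]
    | 1 => simp [semicircleMoment, branchCoeff]
    | k + 2 =>
      rw [semicircleMoment, branchCoeff]
      have h1 : ∀ i : Fin (k + 1), _ := fun i => hd.sum_div_mem_Icc (u := u) subset_rfl
        (fun v _ => ih (k - i) (by omega) v) (semicircleMoment_nonneg _)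
      have h2 : ∀ i : Fin (k + 1), _ := fun i => ih i (by omega) u
      exact ⟨Finset.sum_nonneg fun i _ => mul_nonneg (h2 i).1 (h1 i).1,
        Finset.sum_le_sum fun i _ => mul_le_mul (h2 i).2 (h1 i).2 (h1 i).1
          (semicircleMoment_nonneg _)⟩

variable [DecidableEq V]

theorem IsAdmissible.coeff_pathSeries_div_add_two (hd : G.IsAdmissible d) {S : Finset V} {u : V}
    (hu : u ∈ S) (k : ℕ) :
    PowerSeries.coeff (k + 2) (G.pathSeries S u) / √d ^ (k + 2) =
      ∑ i : Fin (k + 1), PowerSeries.coeff i (G.pathSeries S u) / √d ^ (i : ℕ) *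
        ((∑ v ∈ (S.erase u).filter (G.Adj u),
          PowerSeries.coeff (k - i) (G.pathSeries (S.erase u) v) / √d ^ (k - (i : ℕ))) / d) := by
  have hs : 0 < √d := Real.sqrt_pos.2 hd.pos
  rw [coeff_add_two_pathSeries G hu, Finset.Nat.sum_antidiagonal_eq_sum_range_succ_mk,
    Finset.sum_range, Finset.sum_div]
  refine Finset.sum_congr rfl fun i _ => ?_
  rw [← Finset.sum_div]
  have h : √d ^ (k + 2) = √d ^ (i : ℕ) * √d ^ (k - (i : ℕ)) * d := by
    rw [← pow_add, Nat.add_sub_cancel' (by omega), pow_add, Real.sq_sqrt hd.pos.le]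
  rw [h]
  field_simp

theorem IsAdmissible.coeff_pathSeries_div_mem_Icc (hd : G.IsAdmissible d) (k : ℕ) (S : Finset V)
    {u : V} (hu : u ∈ S) :
    0 ≤ PowerSeries.coeff k (G.pathSeries S u) / √d ^ k ∧
      PowerSeries.coeff k (G.pathSeries S u) / √d ^ k ≤ semicircleMoment k := by
  induction k using Nat.strong_induction_on generalizing S u with
  | _ k ih =>
    match k with
    | 0 => simp [semicircleMoment, coeff_zero_pathSeries G hu]
    | 1 => simp [semicircleMoment, coeff_one_pathSeries G hu]
    | k + 2 =>
      rw [semicircleMoment, hd.coeff_pathSeries_div_add_two hu]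
      have h1 : ∀ i : Fin (k + 1), _ := fun i => hd.sum_div_mem_Icc (u := u)
        (Finset.filter_subset_filter (G.Adj u) (Finset.subset_univ (S.erase u)))
        (fun v hv => ih (k - i) (by omega) (S.erase u) (Finset.mem_filter.1 hv).1)
        (semicircleMoment_nonneg _)
      have h2 : ∀ i : Fin (k + 1), _ := fun i => ih i (by omega) S hu
      exact ⟨Finset.sum_nonneg fun i _ => mul_nonneg (h2 i).1 (h1 i).1,
        Finset.sum_le_sum fun i _ => mul_le_mul (h2 i).2 (h1 i).2 (h1 i).1
          (semicircleMoment_nonneg _)⟩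

theorem IsAdmissible.abs_sum_sub_sum_div_le (hd : G.IsAdmissible d) {u : V} {T : Finset V}
    (hT : T ⊆ Finset.univ.filter (G.Adj u)) {f g : V → ℝ} {B E : ℝ} {s : ℕ}
    (hE : 0 ≤ E) (hB : 0 ≤ B) (hfg : ∀ v ∈ T, |f v - g v| ≤ E) (hg : ∀ v, |g v| ≤ B)
    (hs : (Finset.univ.filter (G.Adj u) \ T).card ≤ s) :
    |(∑ v ∈ T, f v) / d - (∑ v ∈ Finset.univ.filter (G.Adj u), g v) / d| ≤ E + s * B / d := by
  have hd0 := hd.pos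
  rw [← Finset.sum_sdiff hT, ← sub_div, abs_div, abs_of_pos hd0, div_le_iff₀ hd0]
  have h1 : |∑ v ∈ T, f v - ∑ v ∈ T, g v| ≤ d * E := by
    rw [← Finset.sum_sub_distrib]
    calc _ ≤ ∑ v ∈ T, |f v - g v| := Finset.abs_sum_le_sum_abs _ _
      _ ≤ ∑ v ∈ T, E := Finset.sum_le_sum hfg
      _ = T.card * E := by simp
      _ ≤ d * E := by
        gcongr
        exact le_trans (by exact_mod_cast Finset.card_le_card hT) (hd.card_filter_le u)
  have h2 : |∑ v ∈ Finset.univ.filter (G.Adj u) \ T, g v| ≤ s * B := by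
    calc _ ≤ ∑ v ∈ Finset.univ.filter (G.Adj u) \ T, |g v| := Finset.abs_sum_le_sum_abs _ _
      _ ≤ ∑ v ∈ Finset.univ.filter (G.Adj u) \ T, B := Finset.sum_le_sum fun v _ => hg v
      _ = (Finset.univ.filter (G.Adj u) \ T).card * B := by simp
      _ ≤ s * B := by gcongr
  have h3 : (E + s * B / d) * d = d * E + s * B := by field_simp
  rw [h3, ← sub_sub, sub_right_comm]
  exact (abs_sub _ _).trans (add_le_add h1 h2)

end BranchCoeff

/-- Each of the at most `s` missing vertices removes at most one summand, of size O(1/d) after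
normalization. The count `s` varies in the induction because the recursion deletes one more vertex;
`K` depends on `k` and `s` only, not on the graph. -/
theorem exists_abs_coeff_pathSeries_sub_branchCoeff_le (k s : ℕ) :
    ∃ K : ℝ, 0 ≤ K ∧ ∀ {V : Type*} [Fintype V] [DecidableEq V] {G : SimpleGraph V}
      [DecidableRel G.Adj] {d : ℝ}, G.IsAdmissible d → ∀ (S : Finset V) (u : V), u ∈ S →
        (Finset.univ \ S).card ≤ s →
        |PowerSeries.coeff k (G.pathSeries S u) / √d ^ k - G.branchCoeff d k u| ≤ K / d := by
  induction k using Nat.strong_induction_on generalizing s with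
  | _ k ih =>
    match k with
    | 0 => exact ⟨0, le_rfl, fun _ S u hu _ => by simp [branchCoeff, coeff_zero_pathSeries _ hu]⟩
    | 1 => exact ⟨0, le_rfl, fun _ S u hu _ => by simp [branchCoeff, coeff_one_pathSeries _ hu]⟩
    | k + 2 =>
      choose K hK0 hK using ih
      have hlt : ∀ i : Fin (k + 1), (i : ℕ) < k + 2 := fun i => by omega
      have hlt' : ∀ i : Fin (k + 1), k - (i : ℕ) < k + 2 := fun i => by omega
      have hm := semicircleMoment_nonneg
      -- The constant comes from ab − a'b' = (a − a')b + a'(b − b') with b and a' bounded by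
      -- semicircle moments.
      refine ⟨∑ i : Fin (k + 1), (K i (hlt i) s * semicircleMoment (k - i) + semicircleMoment i *
        (K (k - i) (hlt' i) (s + 1) + s * semicircleMoment (k - i))),
        Finset.sum_nonneg fun i _ => ?_, fun {V _ _ G _ d} hd S u hu hs => ?_⟩
      · have := hK0 i (hlt i) s
        have := hK0 (k - i) (hlt' i) (s + 1)
        have := hm i
        have := hm (k - i)
        positivity
      have hd0 := hd.pos
      rw [hd.coeff_pathSeries_div_add_two hu, branchCoeff, ← Finset.sum_sub_distrib,
        Finset.sum_div]
      refine (Finset.abs_sum_le_sum_abs _ _).trans (Finset.sum_le_sum fun i _ => ?_)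
      have hsub := Finset.filter_subset_filter (G.Adj u) (Finset.subset_univ (S.erase u))
      have h1 := hK i (hlt i) s hd S u hu hs
      have h2 := hd.abs_sum_sub_sum_div_le hsub
        (f := fun v => PowerSeries.coeff (k - i) (G.pathSeries (S.erase u) v) / √d ^ (k - (i : ℕ)))
        (g := G.branchCoeff d (k - i)) (B := semicircleMoment (k - i))
        (E := K (k - i) (hlt' i) (s + 1) / d) (s := s)
        (div_nonneg (hK0 _ _ _) hd0.le) (hm _)
        (fun v hv => hK _ (hlt' i) (s + 1) hd _ v (Finset.mem_filter.1 hv).1 (by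
          refine (Finset.card_le_card (t := insert u (Finset.univ \ S)) fun w => ?_).trans
            ((Finset.card_insert_le _ _).trans (by omega))
          simp only [Finset.mem_sdiff, Finset.mem_univ, Finset.mem_erase, Finset.mem_insert]
          tauto))
        (fun v => by
          rw [abs_of_nonneg (hd.branchCoeff_mem_Icc _ v).1]
          exact (hd.branchCoeff_mem_Icc _ v).2)
        -- Here the count is `s`, not `s + 1`: `u` is not its own neighbour, so erasing it loses no
        -- summand.
        (le_trans (Finset.card_le_card fun w => by
          simp only [Finset.mem_sdiff, Finset.mem_filter, Finset.mem_univ, Finset.mem_erase, true_and]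
          rintro ⟨h, h'⟩ hw
          exact h' ⟨⟨h.ne', hw⟩, h⟩) hs)
      have h3 := hd.sum_div_mem_Icc hsub
        (fun v hv => hd.coeff_pathSeries_div_mem_Icc (k - i) (S.erase u) (Finset.mem_filter.1 hv).1)
        (hm _)
      have h4 := hd.branchCoeff_mem_Icc i u
      set a := PowerSeries.coeff i (G.pathSeries S u) / √d ^ (i : ℕ)
      set a' := G.branchCoeff d i u
      set b := (∑ v ∈ (S.erase u).filter (G.Adj u),
          PowerSeries.coeff (k - i) (G.pathSeries (S.erase u) v) / √d ^ (k - (i : ℕ))) / d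
      set b' := (∑ v ∈ Finset.univ.filter (G.Adj u), G.branchCoeff d (k - i) v) / d
      calc |a * b - a' * b'| = |(a - a') * b + a' * (b - b')| := by ring_nf
        _ ≤ |a - a'| * |b| + |a'| * |b - b'| := by
          rw [← abs_mul, ← abs_mul]
          exact abs_add_le _ _
        _ ≤ K i (hlt i) s / d * semicircleMoment (k - i) + semicircleMoment i *
            (K (k - i) (hlt' i) (s + 1) / d + s * semicircleMoment (k - i) / d) := by
          have := hK0 i (hlt i) s
          have := hm i
          rw [abs_of_nonneg h3.1, abs_of_nonneg h4.1]
          gcongr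
          · exact h3.1
          · exact h3.2
          · exact h4.2
        _ = _ := by ring

theorem exists_abs_sum_roots_sub_branchCoeff_le (k : ℕ) :
    ∃ K : ℝ, ∀ {V : Type*} [Fintype V] [Nonempty V] {G : SimpleGraph V}
      [DecidableRel G.Adj] {d : ℝ}, G.IsAdmissible d →
        |(G.matchingPoly.roots.map fun r => (r / √d) ^ k).sum / Fintype.card V -
          (∑ u, G.branchCoeff d k u) / Fintype.card V| ≤ K / d := by
  classical
  obtain ⟨K, hK0, hK⟩ := exists_abs_coeff_pathSeries_sub_branchCoeff_le k 0
  refine ⟨K, fun {V _ _ G _ d} hd => ?_⟩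
  have hV : (0 : ℝ) < Fintype.card V := by exact_mod_cast Fintype.card_pos
  have h : (G.matchingPoly.roots.map fun r => (r / √d) ^ k).sum =
      ∑ u, PowerSeries.coeff k (G.pathSeries Finset.univ u) / √d ^ k := by
    rw [← Finset.sum_div, ← sum_pow_roots_matchingPoly]
    simp only [div_pow, Multiset.sum_map_div]
  rw [← sub_div, abs_div, abs_of_pos hV, div_le_iff₀ hV, h, ← Finset.sum_sub_distrib]
  calc _ ≤ ∑ u : V, K / d := (Finset.abs_sum_le_sum_abs _ _).trans
        (Finset.sum_le_sum fun u _ => hK hd _ u (Finset.mem_univ u) (by simp))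
    _ = _ := by
      simp [mul_comm]

end SimpleGraph

namespace SimpleGraph

/-! ### Asymptotically regular sequences: convergence to the constant solution -/

section RegularLimit

variable {V : Type*} [Fintype V] {G : SimpleGraph V} [DecidableRel G.Adj] {d : ℝ}

/-- Double counting: each `v` occurs once per neighbour, hence at most d times. Averaging over
neighbours thus does not increase L¹ norms. -/
theorem IsAdmissible.sum_sum_adj_div_le (hd : G.IsAdmissible d) {f : V → ℝ} (hf : ∀ v, 0 ≤ f v) :
    ∑ u, (∑ v ∈ Finset.univ.filter (G.Adj u), f v) / d ≤ ∑ v, f v := by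
  rw [← Finset.sum_div, div_le_iff₀ hd.pos,
    Finset.sum_comm' (t' := Finset.univ) (s' := fun v => Finset.univ.filter (G.Adj v)),
    Finset.sum_mul]
  · refine Finset.sum_le_sum fun v _ => ?_
    rw [Finset.sum_const, nsmul_eq_mul, mul_comm]
    exact mul_le_mul_of_nonneg_left (hd.card_filter_le v) (hf v)
  · simp [G.adj_comm]

theorem semicircleMoment_mul_sqrt_pow_add_two {α : ℝ} (hα : 0 ≤ α) (k : ℕ) :
    semicircleMoment (k + 2) * √α ^ (k + 2) = ∑ i : Fin (k + 1),
      semicircleMoment i * √α ^ (i : ℕ) * (α * (semicircleMoment (k - i) * √α ^ (k - (i : ℕ)))) := by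
  rw [semicircleMoment, Finset.sum_mul]
  refine Finset.sum_congr rfl fun i _ => ?_
  have h : √α ^ (k + 2) = √α ^ (i : ℕ) * √α ^ (k - (i : ℕ)) * α := by
    rw [← pow_add, Nat.add_sub_cancel' (by omega), pow_add, Real.sq_sqrt hα]
  rw [h]
  ring

/-- The numbers `semicircleMoment k * √α ^ k` solve the recursion with every degree equal to αd. The
L¹ distance to them is controlled by the distances at lower indices and by the L¹ deviation of the
degrees. -/
theorem IsAdmissible.sum_abs_branchCoeff_sub_le (hd : G.IsAdmissible d) {α : ℝ} (hα : 0 ≤ α)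
    (k : ℕ) :
    ∑ u, |G.branchCoeff d (k + 2) u - semicircleMoment (k + 2) * √α ^ (k + 2)| ≤
      ∑ i : Fin (k + 1),
        (semicircleMoment (k - i) *
            ∑ u, |G.branchCoeff d i u - semicircleMoment i * √α ^ (i : ℕ)| +
          semicircleMoment i * √α ^ (i : ℕ) *
            (∑ u, |G.branchCoeff d (k - i) u - semicircleMoment (k - i) * √α ^ (k - (i : ℕ))| +
              semicircleMoment (k - i) * √α ^ (k - (i : ℕ)) *
                ∑ u, |(G.degree u : ℝ) / d - α|)) := by
  have hd0 := hd.pos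
  have hpt : ∀ u, |G.branchCoeff d (k + 2) u - semicircleMoment (k + 2) * √α ^ (k + 2)| ≤
      ∑ i : Fin (k + 1),
        (semicircleMoment (k - i) * |G.branchCoeff d i u - semicircleMoment i * √α ^ (i : ℕ)| +
          semicircleMoment i * √α ^ (i : ℕ) *
            ((∑ v ∈ Finset.univ.filter (G.Adj u),
              |G.branchCoeff d (k - i) v - semicircleMoment (k - i) * √α ^ (k - (i : ℕ))|) / d +
              semicircleMoment (k - i) * √α ^ (k - (i : ℕ)) * |(G.degree u : ℝ) / d - α|)) := by
    intro u
    rw [branchCoeff, semicircleMoment_mul_sqrt_pow_add_two hα, ← Finset.sum_sub_distrib]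
    refine (Finset.abs_sum_le_sum_abs _ _).trans (Finset.sum_le_sum fun i _ => ?_)
    have hX := hd.sum_div_mem_Icc (u := u) subset_rfl
      (fun v _ => hd.branchCoeff_mem_Icc (k - i) v) (semicircleMoment_nonneg _)
    have hmi : 0 ≤ semicircleMoment i * √α ^ (i : ℕ) :=
      mul_nonneg (semicircleMoment_nonneg _) (by positivity)
    have hmj : 0 ≤ semicircleMoment (k - i) * √α ^ (k - (i : ℕ)) :=
      mul_nonneg (semicircleMoment_nonneg _) (by positivity)
    set X := (∑ v ∈ Finset.univ.filter (G.Adj u), G.branchCoeff d (k - i) v) / d with hXdef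
    set mi := semicircleMoment i * √α ^ (i : ℕ)
    set mj := semicircleMoment (k - i) * √α ^ (k - (i : ℕ))
    have hXd : X - α * mj = (∑ v ∈ Finset.univ.filter (G.Adj u), (G.branchCoeff d (k - i) v - mj)) / d
        + mj * ((G.degree u : ℝ) / d - α) := by
      rw [Finset.sum_sub_distrib, Finset.sum_const, nsmul_eq_mul, ← neighborFinset_eq_filter,
        card_neighborFinset_eq_degree, neighborFinset_eq_filter, sub_div, hXdef]
      ring
    have h1 : |X - α * mj| ≤ (∑ v ∈ Finset.univ.filter (G.Adj u), |G.branchCoeff d (k - i) v - mj|) / d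
        + mj * |(G.degree u : ℝ) / d - α| := by
      rw [hXd]
      refine (abs_add_le _ _).trans ?_
      rw [abs_div, abs_of_pos hd0, abs_mul, abs_of_nonneg hmj]
      gcongr
      exact Finset.abs_sum_le_sum_abs _ _
    calc |G.branchCoeff d i u * X - mi * (α * mj)|
        = |(G.branchCoeff d i u - mi) * X + mi * (X - α * mj)| := by ring_nf
      _ ≤ |G.branchCoeff d i u - mi| * X + mi * |X - α * mj| := by
        refine (abs_add_le _ _).trans ?_
        rw [abs_mul, abs_mul, abs_of_nonneg hX.1, abs_of_nonneg hmi]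
      _ ≤ _ := by
        rw [mul_comm (semicircleMoment _)]
        gcongr
        exact hX.2
  refine (Finset.sum_le_sum fun u _ => hpt u).trans ?_
  rw [Finset.sum_comm]
  refine Finset.sum_le_sum fun i _ => ?_
  rw [Finset.sum_add_distrib, ← Finset.mul_sum, ← Finset.mul_sum, Finset.sum_add_distrib,
    ← Finset.mul_sum]
  have hmi : 0 ≤ semicircleMoment i * √α ^ (i : ℕ) :=
    mul_nonneg (semicircleMoment_nonneg _) (by positivity)
  refine add_le_add le_rfl (mul_le_mul_of_nonneg_left (add_le_add ?_ le_rfl) hmi)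
  exact hd.sum_sum_adj_div_le fun v => abs_nonneg _

end RegularLimit

section Sequences

variable {V : ℕ → Type*} [∀ n, Fintype (V n)] [∀ n, Nonempty (V n)] {G : ∀ n, SimpleGraph (V n)}
  [∀ n, DecidableRel (G n).Adj] {d : ℕ → ℝ}

/-- Convergence in probability upgrades to L¹ because |deg/d − α| ≤ 1. -/
theorem _root_.IsAsympRegular.tendsto_average_abs (hadm : ∀ n, (G n).IsAdmissible (d n)) {α : ℝ}
    (h0 : 0 ≤ α) (h1 : α ≤ 1) (h : IsAsympRegular G d α) :
    Tendsto (fun n => (∑ u, |((G n).degree u : ℝ) / d n - α|) / Fintype.card (V n)) atTop (𝓝 0) := by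
  classical
  rw [Metric.tendsto_atTop]
  intro ε hε
  have h2 := h (ε / 2) (by positivity)
  rw [Metric.tendsto_atTop] at h2
  obtain ⟨N, hN⟩ := h2 (ε / 2) (by positivity)
  refine ⟨N, fun n hn => ?_⟩
  have hV : (0 : ℝ) < Fintype.card (V n) := by exact_mod_cast Fintype.card_pos
  have h3 := hN n hn
  rw [Real.dist_eq, sub_zero, abs_of_nonneg (by positivity)] at h3 ⊢
  have hpt : ∀ u : V n, |((G n).degree u : ℝ) / d n - α| ≤
      ε / 2 + if ε / 2 ≤ |((G n).degree u : ℝ) / d n - α| then 1 else 0 := by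
    intro u
    split_ifs with hu
    · have h4 : ((G n).degree u : ℝ) / d n ≤ 1 := by
        rw [div_le_one (hadm n).pos]
        exact (hadm n).2 u
      have h5 : 0 ≤ ((G n).degree u : ℝ) / d n := div_nonneg (by positivity) (hadm n).pos.le
      have : |((G n).degree u : ℝ) / d n - α| ≤ 1 := abs_le.2 ⟨by linarith, by linarith⟩
      linarith
    · linarith
  have hcard : (Nat.card {v : V n // ε / 2 ≤ |((G n).degree v : ℝ) / d n - α|} : ℝ) =
      ∑ u : V n, if ε / 2 ≤ |((G n).degree u : ℝ) / d n - α| then (1 : ℝ) else 0 := by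
    rw [Nat.card_eq_fintype_card, Fintype.card_subtype, Finset.sum_boole]
  calc _ ≤ (∑ u : V n, (ε / 2 + if ε / 2 ≤ |((G n).degree u : ℝ) / d n - α| then 1 else 0)) /
        Fintype.card (V n) := by
        gcongr with u
        exact hpt u
    _ = ε / 2 + (Nat.card {v : V n // ε / 2 ≤ |((G n).degree v : ℝ) / d n - α|} : ℝ) /
        Fintype.card (V n) := by
      rw [Finset.sum_add_distrib, ← hcard]
      simp
      field_simp
    _ < ε := by linarith

theorem _root_.IsAsympRegular.tendsto_average_abs_branchCoeff_sub
    (hadm : ∀ n, (G n).IsAdmissible (d n)) {α : ℝ}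
    (h0 : 0 ≤ α) (h1 : α ≤ 1) (h : IsAsympRegular G d α) (k : ℕ) :
    Tendsto (fun n => (∑ u, |(G n).branchCoeff (d n) k u - semicircleMoment k * √α ^ k|) /
      Fintype.card (V n)) atTop (𝓝 0) := by
  induction k using Nat.strong_induction_on with
  | _ k ih =>
    match k with
    | 0 => simp [semicircleMoment, branchCoeff]
    | 1 => simp [semicircleMoment, branchCoeff]
    | k + 2 =>
      have hD := h.tendsto_average_abs hadm h0 h1
      have hlim := tendsto_finsetSum (Finset.univ : Finset (Fin (k + 1))) fun i _ =>
        ((ih i (by omega)).const_mul (semicircleMoment (k - i))).add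
          (((ih (k - i) (by omega)).add (hD.const_mul
            (semicircleMoment (k - i) * √α ^ (k - (i : ℕ))))).const_mul
              (semicircleMoment i * √α ^ (i : ℕ)))
      simp only [mul_zero, add_zero, Finset.sum_const_zero] at hlim
      refine squeeze_zero (fun n => by positivity) (fun n => ?_) hlim
      refine (div_le_div_of_nonneg_right ((hadm n).sum_abs_branchCoeff_sub_le h0 k)
        (by positivity)).trans (le_of_eq ?_)
      rw [Finset.sum_div]
      refine Finset.sum_congr rfl fun i _ => ?_
      ring

theorem _root_.IsAsympRegular.tendsto_average_branchCoeff
    (hadm : ∀ n, (G n).IsAdmissible (d n)) {α : ℝ}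
    (h0 : 0 ≤ α) (h1 : α ≤ 1) (h : IsAsympRegular G d α) (k : ℕ) :
    Tendsto (fun n => (∑ u, (G n).branchCoeff (d n) k u) / Fintype.card (V n)) atTop
      (𝓝 (semicircleMoment k * √α ^ k)) := by
  rw [tendsto_iff_norm_sub_tendsto_zero]
  refine squeeze_zero (fun n => norm_nonneg _) (fun n => ?_)
    (h.tendsto_average_abs_branchCoeff_sub hadm h0 h1 k)
  have hV : (0 : ℝ) < Fintype.card (V n) := by exact_mod_cast Fintype.card_pos
  rw [Real.norm_eq_abs, le_div_iff₀ hV, ← abs_of_pos hV, ← abs_mul, abs_of_pos hV, sub_mul,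
    div_mul_cancel₀ _ hV.ne', mul_comm (_ * _), ← nsmul_eq_mul, ← Finset.card_univ,
    ← Finset.sum_const, ← Finset.sum_sub_distrib]
  exact Finset.abs_sum_le_sum_abs _ _

end Sequences

/-! ### Averages of branch coefficients as combinations of tree densities -/

section Trees

/-- The shapes of rooted plane trees: a single root, or two trees with their roots joined by an
edge, rooted at the root of the first. -/
inductive TreeShape
  | leaf
  | graft (a b : TreeShape)

namespace TreeShape

/-- The number of edges. -/
def numEdges : TreeShape → ℕ
  | leaf => 0
  | graft a b => a.numEdges + b.numEdges + 1

/-- The number of homomorphisms of the tree into `G` that map the root to `u`. -/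
def numHoms {V : Type*} [Fintype V] (G : SimpleGraph V) [DecidableRel G.Adj] :
    TreeShape → V → ℕ
  | leaf, _ => 1
  | graft a b, u => a.numHoms G u * ∑ v ∈ Finset.univ.filter (G.Adj u), b.numHoms G v

end TreeShape

/-- Homomorphisms from two rooted graphs joined by an edge between the roots. -/
def homGraftEquiv {U₁ U₂ V : Type*} {F₁ : SimpleGraph U₁} {F₂ : SimpleGraph U₂} {r₁ : U₁} {r₂ : U₂}
    {G : SimpleGraph V} {u : V} :
    {f : (F₁.sum F₂ ⊔ edge (Sum.inl r₁) (Sum.inr r₂)) →g G // f (Sum.inl r₁) = u} ≃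
      {f : F₁ →g G // f r₁ = u} × Σ v : {v // G.Adj u v}, {f : F₂ →g G // f r₂ = v} where
  toFun f := ⟨⟨f.1.comp ((Hom.ofLE le_sup_left).comp Embedding.sumInl.toHom), f.2⟩,
    ⟨f.1 (Sum.inr r₂), by
      have h := f.1.map_adj (v := Sum.inl r₁) (w := Sum.inr r₂) (by simp [edge])
      rwa [f.2] at h⟩,
    ⟨f.1.comp ((Hom.ofLE le_sup_left).comp Embedding.sumInr.toHom), rfl⟩⟩
  invFun p := ⟨⟨Sum.elim p.1.1 p.2.2.1, by
    obtain ⟨⟨f, hf⟩, ⟨v, hv⟩, ⟨g, hg⟩⟩ := p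
    simp only at hg
    rintro (a | a) (b | b) h
    · exact f.map_adj (by simpa [edge] using h)
    · obtain ⟨rfl, rfl⟩ : a = r₁ ∧ b = r₂ := by simpa [edge] using h
      simpa [hf, hg] using hv
    · obtain ⟨rfl, rfl⟩ : a = r₂ ∧ b = r₁ := by simpa [edge] using h
      simpa [hf, hg] using hv.symm
    · exact g.map_adj (by simpa [edge] using h)⟩, p.1.2⟩
  left_inv f := by
    ext (a | a) <;> rfl
  right_inv := by
    rintro ⟨⟨f, hf⟩, ⟨v, hv⟩, ⟨g, hg⟩⟩
    simp only at hg
    subst hg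
    rfl

theorem IsTree.sum_sup_edge {U₁ U₂ : Type*} [Finite U₁] [Finite U₂] {F₁ : SimpleGraph U₁}
    {F₂ : SimpleGraph U₂} (h₁ : F₁.IsTree) (h₂ : F₂.IsTree) (r₁ : U₁) (r₂ : U₂) :
    (F₁.sum F₂ ⊔ edge (Sum.inl r₁) (Sum.inr r₂)).IsTree := by
  classical
  have := Fintype.ofFinite U₁
  have := Fintype.ofFinite U₂
  have hc := h₁.connected.sum_sup_edge (v := r₁) (w := r₂) h₂.connected
  refine isTree_iff_connected_and_card.2 ⟨hc, ?_⟩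
  have e₁ := (isTree_iff_connected_and_card.1 h₁).2
  have e₂ := (isTree_iff_connected_and_card.1 h₂).2
  have e₃ := (F₁.sum F₂).card_edgeFinset_sup_edge (s := Sum.inl r₁) (t := Sum.inr r₂)
    (by simp) (by simp)
  have e₄ := Nat.card_congr (edgeSetSumEquiv (G := F₁) (H := F₂))
  rw [edgeFinset_card, edgeFinset_card, ← Nat.card_eq_fintype_card,
    ← Nat.card_eq_fintype_card] at e₃
  rw [Nat.card_sum] at e₄ ⊢
  omega

theorem TreeShape.exists_isTree (T : TreeShape) :
    ∃ (U : Type) (_ : Finite U) (F : SimpleGraph U) (r : U), F.IsTree ∧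
      Nat.card U = T.numEdges + 1 ∧
      ∀ {V : Type*} [Fintype V] (G : SimpleGraph V) [DecidableRel G.Adj] (u : V),
        Nat.card {f : F →g G // f r = u} = T.numHoms G u := by
  induction T with
  | leaf =>
    refine ⟨Unit, inferInstance, ⊥, (), IsTree.of_subsingleton, by simp [numEdges], ?_⟩
    intro V _ G _ u
    rw [numHoms, Nat.card_eq_one_iff_unique]
    refine ⟨⟨?_⟩, ⟨⟨⟨fun _ => u, by simp⟩, rfl⟩⟩⟩
    rintro ⟨f, hf⟩ ⟨g, hg⟩
    ext ⟨⟩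
    exact hf.trans hg.symm
  | graft a b iha ihb =>
    obtain ⟨U₁, _, F₁, r₁, h₁, hc₁, hh₁⟩ := iha
    obtain ⟨U₂, _, F₂, r₂, h₂, hc₂, hh₂⟩ := ihb
    refine ⟨U₁ ⊕ U₂, inferInstance, _, Sum.inl r₁, h₁.sum_sup_edge h₂ r₁ r₂, ?_, ?_⟩
    · rw [Nat.card_sum, hc₁, hc₂, numEdges]
      ring
    · intro V _ G _ u
      have : Finite (F₂ →g G) := DFunLike.finite _
      rw [Nat.card_congr homGraftEquiv, Nat.card_prod, Nat.card_sigma, hh₁, numHoms]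
      simp only [hh₂]
      congr 1
      exact (Finset.sum_subtype _ (by simp) _).symm

theorem TreeShape.exists_homDensity_eq (T : TreeShape) :
    ∃ (k : ℕ) (F : SimpleGraph (Fin k)), F.IsTree ∧
      ∀ {V : Type*} [Fintype V] (G : SimpleGraph V) [DecidableRel G.Adj] (d : ℝ),
        F.homDensity G d = (∑ u, (T.numHoms G u : ℝ) / d ^ T.numEdges) / Fintype.card V := by
  obtain ⟨U, _, F, r, hF, hc, hh⟩ := T.exists_isTree
  let e := Finite.equivFin U
  refine ⟨Nat.card U, F.map e.toEmbedding, (Iso.map e F).isTree_iff.1 hF, ?_⟩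
  intro V _ G _ d
  have : Finite (F →g G) := DFunLike.finite _
  have h1 : Nat.card (F.map e.toEmbedding →g G) = Nat.card (F →g G) :=
    Nat.card_congr
      { toFun := fun f => f.comp (Iso.map e F).toHom
        invFun := fun f => f.comp (Iso.map e F).symm.toHom
        left_inv := fun f => by ext; simp
        right_inv := fun f => by ext; simp }
  have h2 : Nat.card (F →g G) = ∑ u, T.numHoms G u := by
    rw [← Nat.card_congr (Equiv.sigmaFiberEquiv fun f : F →g G => f r), Nat.card_sigma]
    exact Finset.sum_congr rfl fun u _ => hh G u
  rw [homDensity, h1, h2, Fintype.card_fin, hc, Nat.add_sub_cancel, ← Finset.sum_div, div_div,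
    mul_comm]
  push_cast
  rfl

variable {V : ℕ → Type*} [∀ n, Fintype (V n)] {G : ∀ n, SimpleGraph (V n)}
  [∀ n, DecidableRel (G n).Adj] {d : ℕ → ℝ}

variable (G d) in
/-- The normalized counts of rooted tree homomorphisms, for a sequence of graphs. -/
noncomputable def TreeShape.rootedDensity (T : TreeShape) (n : ℕ) (u : V n) : ℝ :=
  (T.numHoms (G n) u : ℝ) / d n ^ T.numEdges

variable (G d) in
/-- The linear span of the normalized counts of rooted tree homomorphisms. -/
noncomputable def treeSpan : Submodule ℝ (∀ n, V n → ℝ) :=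
  Submodule.span ℝ (Set.range (TreeShape.rootedDensity G d))

/-- The operation is bilinear, and on two tree counts it is the count of the grafted tree; the new
edge accounts for the extra factor 1/d. -/
theorem mul_sum_div_mem_treeSpan {f g : ∀ n, V n → ℝ} (hf : f ∈ treeSpan G d)
    (hg : g ∈ treeSpan G d) :
    (fun n u => f n u * ((∑ v ∈ Finset.univ.filter ((G n).Adj u), g n v) / d n)) ∈ treeSpan G d := by
  refine Submodule.span_induction ?_ ?_ (fun f f' _ _ hf hf' => ?_) (fun c f _ hf => ?_) hf
  · rintro _ ⟨a, rfl⟩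
    refine Submodule.span_induction ?_ ?_ (fun g g' _ _ hg hg' => ?_) (fun c g _ hg => ?_) hg
    · rintro _ ⟨b, rfl⟩
      refine Submodule.subset_span ⟨TreeShape.graft a b, ?_⟩
      ext n u
      simp only [TreeShape.rootedDensity, TreeShape.numHoms, TreeShape.numEdges]
      push_cast
      rw [← Finset.sum_div]
      ring
    · convert (treeSpan G d).zero_mem using 1
      ext n u
      simp
    · convert (treeSpan G d).add_mem hg hg' using 1
      ext n u
      simp only [Pi.add_apply, Finset.sum_add_distrib]
      ring
    · convert (treeSpan G d).smul_mem c hg using 1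
      ext n u
      simp only [Pi.smul_apply, smul_eq_mul, ← Finset.mul_sum]
      ring
  · convert (treeSpan G d).zero_mem using 1
    ext n u
    simp
  · convert (treeSpan G d).add_mem hf hf' using 1
    ext n u
    simp only [Pi.add_apply]
    ring
  · convert (treeSpan G d).smul_mem c hf using 1
    ext n u
    simp only [Pi.smul_apply, smul_eq_mul]
    ring

/-- The span is taken in functions of `n` and `u` together, so the coefficients of the combination
do not depend on `n` and limits can be taken term by term. -/
theorem branchCoeff_mem_treeSpan (k : ℕ) :
    (fun n u => (G n).branchCoeff (d n) k u) ∈ treeSpan G d := by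
  induction k using Nat.strong_induction_on with
  | _ k ih =>
    match k with
    | 0 =>
      refine Submodule.subset_span ⟨TreeShape.leaf, ?_⟩
      ext n u
      simp [TreeShape.rootedDensity, TreeShape.numHoms, TreeShape.numEdges, branchCoeff]
    | 1 =>
      convert (treeSpan G d).zero_mem using 1
      ext n u
      simp [branchCoeff]
    | k + 2 =>
      convert (treeSpan G d).sum_mem (t := (Finset.univ : Finset (Fin (k + 1)))) fun i _ =>
        mul_sum_div_mem_treeSpan (ih i (by omega)) (ih (k - i) (by omega)) using 1
      ext n u
      simp only [branchCoeff, Finset.sum_apply]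

theorem _root_.TreeDensitiesConverge.exists_tendsto_average (h : TreeDensitiesConverge G d)
    {f : ∀ n, V n → ℝ} (hf : f ∈ treeSpan G d) :
    ∃ t, Tendsto (fun n => (∑ u, f n u) / Fintype.card (V n)) atTop (𝓝 t) := by
  refine Submodule.span_induction ?_ ?_ ?_ ?_ hf
  · rintro _ ⟨T, rfl⟩
    obtain ⟨k, F, hF, hFd⟩ := T.exists_homDensity_eq
    obtain ⟨t, ht⟩ := h k F hF
    exact ⟨t, ht.congr fun n => hFd (G n) (d n)⟩
  · exact ⟨0, by simp⟩
  · rintro f g _ _ ⟨s, hs⟩ ⟨t, ht⟩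
    exact ⟨s + t, by simpa only [Pi.add_apply, Finset.sum_add_distrib, add_div] using hs.add ht⟩
  · rintro c f _ ⟨s, hs⟩
    exact ⟨c * s, by
      simpa only [Pi.smul_apply, smul_eq_mul, ← Finset.mul_sum, mul_div_assoc] using hs.const_mul c⟩

end Trees

end SimpleGraph

/-! ### The method of moments on a compact interval -/

section MomentMethod

variable {a b : ℝ}

theorem ae_mem_Icc_of_measure_compl_eq_zero {μ : Measure ℝ} (h : μ (Set.Icc a b)ᶜ = 0) :
    ∀ᵐ x ∂μ, x ∈ Set.Icc a b :=
  mem_ae_iff.2 h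

theorem Continuous.integrable_of_measure_compl_Icc_eq_zero {μ : Measure ℝ} [IsFiniteMeasure μ]
    (h : μ (Set.Icc a b)ᶜ = 0) {f : ℝ → ℝ} (hf : Continuous f) : Integrable f μ := by
  have := hf.continuousOn.integrableOn_compact (μ := μ) (isCompact_Icc (a := a) (b := b))
  rwa [IntegrableOn, Measure.restrict_eq_self_of_ae_mem
    (ae_mem_Icc_of_measure_compl_eq_zero h)] at this

theorem MeasureTheory.ProbabilityMeasure.tendsto_integral_of_tendsto_of_measure_compl_Icc
    {ι : Type*} {l : Filter ι} (hab : a ≤ b) {μ : ι → ProbabilityMeasure ℝ}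
    {ν : ProbabilityMeasure ℝ} (hμ : ∀ n, (μ n : Measure ℝ) (Set.Icc a b)ᶜ = 0)
    (hν : (ν : Measure ℝ) (Set.Icc a b)ᶜ = 0) (h : Tendsto μ l (𝓝 ν)) {f : ℝ → ℝ}
    (hf : Continuous f) :
    Tendsto (fun n => ∫ x, f x ∂(μ n : Measure ℝ)) l (𝓝 (∫ x, f x ∂(ν : Measure ℝ))) := by
  -- A continuous `f` need not be bounded on ℝ; composing with the projection to `[a, b]` makes it
  -- bounded and changes it only off the supports.
  let g : BoundedContinuousFunction ℝ ℝ :=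
    (BoundedContinuousFunction.mkOfCompact (⟨fun x : Set.Icc a b => f x, by fun_prop⟩ :
      C(Set.Icc a b, ℝ))).compContinuous ⟨Set.projIcc a b hab, continuous_projIcc⟩
  have hg : ∀ m : Measure ℝ, m (Set.Icc a b)ᶜ = 0 → ∫ x, f x ∂m = ∫ x, g x ∂m := fun m hm => by
    refine integral_congr_ae ?_
    filter_upwards [ae_mem_Icc_of_measure_compl_eq_zero hm] with x hx
    simp [g, Set.projIcc_of_mem hab hx]
  simp only [hg _ hν, fun n => hg _ (hμ n)]
  exact ProbabilityMeasure.tendsto_iff_forall_integral_tendsto.1 h g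

theorem integral_polynomial_eq_sum {μ : Measure ℝ} [IsFiniteMeasure μ]
    (h : μ (Set.Icc a b)ᶜ = 0) (p : ℝ[X]) :
    ∫ x, p.eval x ∂μ = ∑ k ∈ Finset.range (p.natDegree + 1), p.coeff k * ∫ x, x ^ k ∂μ := by
  simp only [Polynomial.eval_eq_sum_range]
  rw [integral_finsetSum]
  · simp only [integral_const_mul]
  · exact fun k _ => Continuous.integrable_of_measure_compl_Icc_eq_zero h (by fun_prop)

theorem abs_integral_sub_integral_le {μ : Measure ℝ} [IsProbabilityMeasure μ]
    (h : μ (Set.Icc a b)ᶜ = 0) {f g : ℝ → ℝ} (hf : Continuous f) (hg : Continuous g) {ε : ℝ}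
    (hfg : ∀ x ∈ Set.Icc a b, |f x - g x| ≤ ε) :
    |∫ x, f x ∂μ - ∫ x, g x ∂μ| ≤ ε := by
  rw [← integral_sub (hf.integrable_of_measure_compl_Icc_eq_zero h)
    (hg.integrable_of_measure_compl_Icc_eq_zero h)]
  have := norm_integral_le_of_norm_le_const (μ := μ) (f := fun x => f x - g x) (C := ε) (by
    filter_upwards [ae_mem_Icc_of_measure_compl_eq_zero h] with x hx using hfg x hx)
  simpa using this

/-- Weierstrass approximation on `[a, b]`: integrals of polynomials converge by linearity, and a
uniform error ε/3 is paid twice. -/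
theorem MeasureTheory.ProbabilityMeasure.tendsto_of_tendsto_moments
    {ι : Type*} {l : Filter ι} {μ : ι → ProbabilityMeasure ℝ} {ν : ProbabilityMeasure ℝ}
    (hμ : ∀ n, (μ n : Measure ℝ) (Set.Icc a b)ᶜ = 0) (hν : (ν : Measure ℝ) (Set.Icc a b)ᶜ = 0)
    (h : ∀ k : ℕ, Tendsto (fun n => ∫ x, x ^ k ∂(μ n : Measure ℝ)) l
      (𝓝 (∫ x, x ^ k ∂(ν : Measure ℝ)))) :
    Tendsto μ l (𝓝 ν) := by
  rw [ProbabilityMeasure.tendsto_iff_forall_integral_tendsto]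
  intro f
  rw [Metric.tendsto_nhds]
  intro ε hε
  obtain ⟨p, hp⟩ := exists_polynomial_near_of_continuousOn a b f f.continuous.continuousOn (ε / 3)
    (by positivity)
  have hp' : ∀ x ∈ Set.Icc a b, |p.eval x - f x| ≤ ε / 3 := fun x hx => (hp x hx).le
  have hpoly : Tendsto (fun n => ∫ x, p.eval x ∂(μ n : Measure ℝ)) l
      (𝓝 (∫ x, p.eval x ∂(ν : Measure ℝ))) := by
    simp only [integral_polynomial_eq_sum hν, fun n => integral_polynomial_eq_sum (hμ n)]
    exact tendsto_finsetSum _ fun k _ => (h k).const_mul _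
  filter_upwards [Metric.tendsto_nhds.1 hpoly (ε / 3) (by positivity)] with n hn
  have h1 := abs_le.1 (abs_integral_sub_integral_le (hμ n) p.continuous f.continuous hp')
  have h2 := abs_le.1 (abs_integral_sub_integral_le hν p.continuous f.continuous hp')
  rw [Real.dist_eq, abs_lt] at hn ⊢
  constructor <;> linarith [h1.1, h1.2, h2.1, h2.2]

/-- Compactness supplies a limit along an ultrafilter; its moments must be the given limits, so
`tendsto_of_tendsto_moments` upgrades this to convergence of the whole sequence. -/
theorem MeasureTheory.ProbabilityMeasure.exists_tendsto_of_moments_tendsto (hab : a ≤ b)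
    {μ : ℕ → ProbabilityMeasure ℝ} (hμ : ∀ n, (μ n : Measure ℝ) (Set.Icc a b)ᶜ = 0)
    (h : ∀ k : ℕ, ∃ t, Tendsto (fun n => ∫ x, x ^ k ∂(μ n : Measure ℝ)) atTop (𝓝 t)) :
    ∃ ν : ProbabilityMeasure ℝ, (ν : Measure ℝ) (Set.Icc a b)ᶜ = 0 ∧ Tendsto μ atTop (𝓝 ν) := by
  -- Tightness in its degenerate form: no mass at all is allowed outside `[a, b]`.
  have hc := isCompact_setOfPred_probabilityMeasure_mass_eq_compl_isCompact_le
    (u := fun _ => 0) (K := fun _ => Set.Icc a b) tendsto_const_nhds (fun _ => isCompact_Icc)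
    (Or.inr monotone_const)
  obtain ⟨ν, hν, hlim⟩ := hc.ultrafilter_le_nhds' ((hyperfilter ℕ).map μ) (by
    rw [Ultrafilter.mem_map]
    refine Filter.univ_mem' fun n => ?_
    intro _
    rw [ProbabilityMeasure.coeFn_def]
    simp [hμ n])
  have hν0 : (ν : Measure ℝ) (Set.Icc a b)ᶜ = 0 := by
    have := hν 0
    rw [ProbabilityMeasure.coeFn_def] at this
    simpa [ENNReal.toNNReal_eq_zero_iff] using this
  refine ⟨ν, hν0, ProbabilityMeasure.tendsto_of_tendsto_moments hμ hν0 fun k => ?_⟩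
  obtain ⟨t, ht⟩ := h k
  have hle : (hyperfilter ℕ : Filter ℕ) ≤ atTop := by
    rw [← Nat.cofinite_eq_atTop]
    exact hyperfilter_le_cofinite
  have h1 := ProbabilityMeasure.tendsto_integral_of_tendsto_of_measure_compl_Icc hab hμ hν0
    (l := (hyperfilter ℕ : Filter ℕ)) hlim (continuous_pow k)
  rwa [tendsto_nhds_unique h1 (ht.mono_left hle)]

end MomentMethod

namespace SimpleGraph

/-! ### The matching measure and the logarithmic integral -/

section MatchingMeasure

theorem sum_dirac_apply_compl_eq_zero {s : Multiset ℝ} {t : Set ℝ} (ht : MeasurableSet t)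
    (h : ∀ x ∈ s, x ∈ t) : (s.map Measure.dirac).sum tᶜ = 0 := by
  induction s using Multiset.induction with
  | empty => simp
  | cons x s ih =>
    simp only [Multiset.map_cons, Multiset.sum_cons, Measure.add_apply]
    rw [ih fun y hy => h y (Multiset.mem_cons_of_mem hy), Measure.dirac_apply' _ ht.compl]
    simp [h x (Multiset.mem_cons_self x s)]

theorem sum_dirac_apply_univ (s : Multiset ℝ) :
    (s.map Measure.dirac).sum Set.univ = s.card := by
  induction s using Multiset.induction with
  | empty => simp
  | cons x s ih =>
    simp only [Multiset.map_cons, Multiset.sum_cons, Measure.add_apply, ih]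
    simp [add_comm]

theorem integrable_and_integral_sum_dirac (s : Multiset ℝ) (f : ℝ → ℝ) :
    Integrable f (s.map Measure.dirac).sum ∧
      ∫ x, f x ∂(s.map Measure.dirac).sum = (s.map f).sum := by
  induction s using Multiset.induction with
  | empty => simp
  | cons x s ih =>
    have hx : Integrable f (Measure.dirac x) := integrable_dirac (by simp)
    simp only [Multiset.map_cons, Multiset.sum_cons]
    exact ⟨hx.add_measure ih.1, by rw [integral_add_measure hx ih.1, ih.2, integral_dirac]⟩

variable {V : Type*} [Fintype V] (G : SimpleGraph V) (d : ℝ)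

theorem matchingMeasure_eq :
    G.matchingMeasure d = (Fintype.card V : ℝ≥0∞)⁻¹ •
      ((G.matchingPoly.roots.map fun r => r / √d).map Measure.dirac).sum := by
  rw [matchingMeasure, Multiset.map_map]
  rfl

theorem integral_matchingMeasure (f : ℝ → ℝ) :
    ∫ x, f x ∂G.matchingMeasure d =
      (G.matchingPoly.roots.map fun r => f (r / √d)).sum / Fintype.card V := by
  rw [matchingMeasure_eq, integral_smul_measure, (integrable_and_integral_sum_dirac _ f).2,
    Multiset.map_map]
  simp [div_eq_inv_mul]

theorem isProbabilityMeasure_matchingMeasure [Nonempty V] :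
    IsProbabilityMeasure (G.matchingMeasure d) := by
  constructor
  rw [matchingMeasure_eq, Measure.smul_apply, sum_dirac_apply_univ, Multiset.card_map,
    card_roots_matchingPoly, smul_eq_mul]
  exact ENNReal.inv_mul_cancel (by simp) (by simp)

variable {G d} in
theorem IsAdmissible.matchingMeasure_compl_Icc [DecidableRel G.Adj] (hd : G.IsAdmissible d) :
    G.matchingMeasure d (Set.Icc (-2) 2)ᶜ = 0 := by
  rw [matchingMeasure_eq, Measure.smul_apply, sum_dirac_apply_compl_eq_zero measurableSet_Icc,
    smul_zero]
  intro x hx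
  obtain ⟨r, hr, rfl⟩ := Multiset.mem_map.1 hx
  have hs : 0 < √d := Real.sqrt_pos.2 hd.pos
  rw [Set.mem_Icc, ← abs_le, abs_div, abs_of_pos hs, div_le_iff₀ hs]
  exact G.abs_le_of_mem_roots_matchingPoly hd hr

/-- The matching measure as a probability measure. -/
noncomputable def matchingProbabilityMeasure [Nonempty V] : ProbabilityMeasure ℝ :=
  ⟨G.matchingMeasure d, G.isProbabilityMeasure_matchingMeasure d⟩

variable {G d} in
-- Take logarithms in `totalMatchings_sq`, using 1 + r² = d(1/d + (r/√d)²); the v factors d account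
-- for the division by d.
theorem IsAdmissible.log_totalMatchings_eq_integral [Nonempty V] [DecidableRel G.Adj]
    (hd : G.IsAdmissible d) :
    0 < (G.totalMatchings : ℝ) ∧
    Real.log ((G.totalMatchings : ℝ) ^ ((2 : ℝ) / (Fintype.card V : ℝ)) / d) =
      ∫ x, Real.log (d⁻¹ + x ^ 2) ∂G.matchingMeasure d := by
  have hd0 := hd.pos
  have hV : (0 : ℝ) < Fintype.card V := by exact_mod_cast Fintype.card_pos
  have hsq := G.totalMatchings_sq
  have hM : 0 < (G.totalMatchings : ℝ) := by
    have h : 0 < (G.totalMatchings : ℝ) ^ 2 := by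
      rw [hsq]
      refine Multiset.prod_pos fun x hx => ?_
      obtain ⟨r, -, rfl⟩ := Multiset.mem_map.1 hx
      positivity
    exact lt_of_le_of_ne (by positivity) fun h0 => by simp [← h0] at h
  refine ⟨hM, ?_⟩
  have hlog : 2 * Real.log G.totalMatchings =
      (G.matchingPoly.roots.map fun r => Real.log (1 + r ^ 2)).sum := by
    have : Real.log ((G.totalMatchings : ℝ) ^ 2) = 2 * Real.log G.totalMatchings := by
      rw [Real.log_pow]
      norm_num
    rw [← this, hsq, Real.log_multiset_prod, Multiset.map_map]
    · rfl
    · intro x hx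
      obtain ⟨r, -, rfl⟩ := Multiset.mem_map.1 hx
      positivity
  have hpt : ∀ r : ℝ, Real.log (d⁻¹ + (r / √d) ^ 2) = Real.log (1 + r ^ 2) - Real.log d := by
    intro r
    rw [← Real.log_div (by positivity) hd0.ne', div_pow, Real.sq_sqrt hd0.le]
    congr 1
    field_simp
  rw [Real.log_div (Real.rpow_pos_of_pos hM _).ne' hd0.ne', Real.log_rpow hM,
    integral_matchingMeasure]
  simp only [hpt]
  rw [Multiset.sum_map_sub, Multiset.map_const', Multiset.sum_replicate, card_roots_matchingPoly,
    ← hlog, nsmul_eq_mul]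
  field_simp

end MatchingMeasure

section Limits

variable {V : ℕ → Type*} [∀ n, Fintype (V n)] [∀ n, Nonempty (V n)] {G : ∀ n, SimpleGraph (V n)}
  [∀ n, DecidableRel (G n).Adj] {d : ℕ → ℝ}

theorem tendsto_moment_matchingMeasure (hadm : ∀ n, (G n).IsAdmissible (d n))
    (hd : Tendsto d atTop atTop) {k : ℕ} {t : ℝ}
    (h : Tendsto (fun n => (∑ u, (G n).branchCoeff (d n) k u) / Fintype.card (V n)) atTop (𝓝 t)) :
    Tendsto (fun n => ∫ x, x ^ k ∂(G n).matchingMeasure (d n)) atTop (𝓝 t) := by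
  obtain ⟨K, hK⟩ := exists_abs_sum_roots_sub_branchCoeff_le k
  have h1 : Tendsto (fun n => ∫ x, x ^ k ∂(G n).matchingMeasure (d n) -
      (∑ u, (G n).branchCoeff (d n) k u) / Fintype.card (V n)) atTop (𝓝 0) := by
    refine squeeze_zero_norm (fun n => ?_) (hd.const_div_atTop K)
    rw [integral_matchingMeasure, Real.norm_eq_abs]
    exact hK (hadm n)
  simpa using h1.add h

theorem exists_tendsto_matchingProbabilityMeasure (hadm : ∀ n, (G n).IsAdmissible (d n))
    (hd : Tendsto d atTop atTop) (h : TreeDensitiesConverge G d) :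
    ∃ ρ : ProbabilityMeasure ℝ, (ρ : Measure ℝ) (Set.Icc (-2) 2)ᶜ = 0 ∧
      Tendsto (fun n => (G n).matchingProbabilityMeasure (d n)) atTop (𝓝 ρ) := by
  refine ProbabilityMeasure.exists_tendsto_of_moments_tendsto (by norm_num)
    (fun n => (hadm n).matchingMeasure_compl_Icc) fun k => ?_
  obtain ⟨t, ht⟩ := h.exists_tendsto_average (branchCoeff_mem_treeSpan k)
  exact ⟨t, tendsto_moment_matchingMeasure hadm hd ht⟩

end Limits

end SimpleGraph

/-! ### Semicircle moments and Catalan numbers -/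

section SemicircleMoments

theorem Finset.sum_range_two_mul_add_one_of_odd_eq_zero {f : ℕ → ℝ} (hf : ∀ i, f (2 * i + 1) = 0)
    (j : ℕ) : ∑ i ∈ Finset.range (2 * j + 1), f i = ∑ i ∈ Finset.range (j + 1), f (2 * i) := by
  induction j with
  | zero => simp
  | succ j ih =>
    rw [Finset.sum_range_succ _ (j + 1), ← ih, show 2 * (j + 1) + 1 = 2 * j + 1 + 1 + 1 by ring,
      Finset.sum_range_succ, Finset.sum_range_succ, hf, add_zero]
    rfl

theorem semicircleMoment_odd (j : ℕ) : semicircleMoment (2 * j + 1) = 0 := by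
  induction j using Nat.strong_induction_on with
  | _ j ih =>
    rcases j with _ | j
    · simp [semicircleMoment]
    · rw [show 2 * (j + 1) + 1 = 2 * j + 1 + 2 by ring, semicircleMoment]
      refine Finset.sum_eq_zero fun i _ => ?_
      rcases Nat.even_or_odd' (i : ℕ) with ⟨m, hm | hm⟩
      · rw [show 2 * j + 1 - (i : ℕ) = 2 * (j - m) + 1 by omega, ih _ (by omega), mul_zero]
      · rw [hm, ih _ (by omega), zero_mul]

theorem semicircleMoment_even (j : ℕ) : semicircleMoment (2 * j) = catalan j := by
  induction j using Nat.strong_induction_on with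
  | _ j ih =>
    rcases j with _ | j
    · simp [semicircleMoment]
    · rw [show 2 * (j + 1) = 2 * j + 2 by ring, semicircleMoment, catalan_succ,
        Fin.sum_univ_eq_sum_range (fun i => semicircleMoment i * semicircleMoment (2 * j - i)),
        Finset.sum_range_two_mul_add_one_of_odd_eq_zero fun i => by
          rw [semicircleMoment_odd, zero_mul],
        Fin.sum_univ_eq_sum_range (fun i => catalan i * catalan (j - i))]
      push_cast
      refine Finset.sum_congr rfl fun i hi => ?_
      have := Finset.mem_range.1 hi
      rw [← Nat.mul_sub, ih _ (by omega), ih _ (by omega)]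

/-- This two-step form is the one that integration by parts yields for the integrals, so it
identifies the two sequences. -/
theorem semicircleMoment_recurrence (k : ℕ) :
    (k + 4) * semicircleMoment (k + 2) = 4 * (k + 1) * semicircleMoment k := by
  rcases Nat.even_or_odd' k with ⟨j, rfl | rfl⟩
  · rw [show 2 * j + 2 = 2 * (j + 1) by ring, semicircleMoment_even, semicircleMoment_even]
    have h1 : ((j : ℝ) + 1) * catalan j = Nat.centralBinom j := by
      exact_mod_cast succ_mul_catalan_eq_centralBinom j
    have h2 : ((j : ℝ) + 2) * catalan (j + 1) = Nat.centralBinom (j + 1) := by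
      exact_mod_cast succ_mul_catalan_eq_centralBinom (j + 1)
    have h3 : ((j : ℝ) + 1) * Nat.centralBinom (j + 1) = 2 * (2 * j + 1) * Nat.centralBinom j := by
      exact_mod_cast Nat.succ_mul_centralBinom_succ j
    have h4 : (j : ℝ) + 1 ≠ 0 := by positivity
    push_cast
    apply mul_left_cancel₀ h4
    linear_combination 2 * (j + 1 : ℝ) * h2 + 2 * h3 - 4 * (2 * j + 1 : ℝ) * h1
  · rw [show 2 * j + 1 + 2 = 2 * (j + 1) + 1 by ring, semicircleMoment_odd, semicircleMoment_odd,
      mul_zero, mul_zero]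

end SemicircleMoments

/-! ### Moments and logarithmic integral of Wigner's law -/

section WignerIntegrals

theorem integral_wignerMeasure (f : ℝ → ℝ) :
    ∫ x, f x ∂wignerMeasure = ∫ x in (-2 : ℝ)..2, semicircleDensity x * f x := by
  rw [wignerMeasure, integral_withDensity_eq_integral_toReal_smul
    (by have := continuous_semicircleDensity; fun_prop) (by simp),
    intervalIntegral.integral_of_le (by norm_num), setIntegral_eq_integral_of_forall_compl_eq_zero]
  · simp only [ENNReal.toReal_ofReal (semicircleDensity_nonneg _), smul_eq_mul]
  · intro x hx
    rw [semicircleDensity_eq_zero hx, zero_mul]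

theorem integrable_wignerMeasure {f : ℝ → ℝ}
    (hf : IntervalIntegrable (fun x => semicircleDensity x * f x) volume (-2) 2) :
    Integrable f wignerMeasure := by
  rw [wignerMeasure, integrable_withDensity_iff_integrable_smul'
    (by have := continuous_semicircleDensity; fun_prop) (by simp)]
  simp only [ENNReal.toReal_ofReal (semicircleDensity_nonneg _), smul_eq_mul]
  rw [intervalIntegrable_iff_integrableOn_Ioc_of_le (by norm_num)] at hf
  refine hf.integrable_of_forall_notMem_eq_zero fun x hx => ?_
  rw [semicircleDensity_eq_zero hx, zero_mul]

theorem wignerMeasure_compl_Icc : wignerMeasure (Set.Icc (-2) 2)ᶜ = 0 := by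
  rw [wignerMeasure, withDensity_apply _ measurableSet_Icc.compl,
    setLIntegral_congr_fun (g := 0) measurableSet_Icc.compl]
  · simp
  · intro x hx
    have : x ∉ Set.Ioc (-2 : ℝ) 2 := fun h => hx (Set.Ioc_subset_Icc_self h)
    simp [semicircleDensity_eq_zero this]

theorem integral_pow_mul_sqrt_recurrence (k : ℕ) :
    (k + 4) * ∫ x in (-2 : ℝ)..2, x ^ (k + 2) * √(4 - x ^ 2) =
      4 * (k + 1) * ∫ x in (-2 : ℝ)..2, x ^ k * √(4 - x ^ 2) := by
  -- The primitive x^(k+1) (4 − x²)^(3/2) vanishes at both endpoints.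
  have h := intervalIntegral.integral_eq_sub_of_hasDerivAt_of_le (a := (-2 : ℝ)) (b := 2)
    (f := fun x => x ^ (k + 1) * ((4 - x ^ 2) * √(4 - x ^ 2)))
    (f' := fun x => 4 * (k + 1) * (x ^ k * √(4 - x ^ 2)) -
      (k + 4) * (x ^ (k + 2) * √(4 - x ^ 2))) (by norm_num)
    (by fun_prop) (fun x hx => by
      have hx' : 0 < 4 - x ^ 2 := by nlinarith [hx.1, hx.2]
      have h1 : HasDerivAt (fun x : ℝ => 4 - x ^ 2) (-(2 * x)) x := by
        simpa using (hasDerivAt_pow 2 x).const_sub 4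
      have h2 := (hasDerivAt_pow (k + 1) x).mul (h1.mul (h1.sqrt hx'.ne'))
      convert! h2 using 1
      have hs : 0 < √(4 - x ^ 2) := Real.sqrt_pos.2 hx'
      have hs2 : (4 - x ^ 2) * (-(2 * x) / (2 * √(4 - x ^ 2))) = -x * √(4 - x ^ 2) := by
        rw [mul_div_assoc', div_eq_iff (by positivity)]
        linear_combination 2 * x * Real.sq_sqrt hx'.le
      simp only [Pi.mul_apply, Nat.add_sub_cancel]
      rw [hs2]
      push_cast
      ring)
    (by apply Continuous.intervalIntegrable; fun_prop)
  rw [intervalIntegral.integral_sub (by apply Continuous.intervalIntegrable; fun_prop)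
    (by apply Continuous.intervalIntegrable; fun_prop), intervalIntegral.integral_const_mul,
    intervalIntegral.integral_const_mul] at h
  norm_num at h
  linarith

theorem integral_pow_wignerMeasure (k : ℕ) :
    ∫ x, x ^ k ∂wignerMeasure = semicircleMoment k := by
  have h1 : ∀ k, ∫ x, x ^ k ∂wignerMeasure =
      (∫ x in (-2 : ℝ)..2, x ^ k * √(4 - x ^ 2)) / (2 * Real.pi) := by
    intro k
    rw [integral_wignerMeasure, ← intervalIntegral.integral_div]
    congr 1
    ext x
    rw [semicircleDensity]
    ring
  induction k using Nat.twoStepInduction with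
  | zero => simp [semicircleMoment]
  | one =>
    rw [h1]
    have h2 := intervalIntegral.integral_comp_neg (a := (-2 : ℝ)) (b := 2)
      fun x => x ^ 1 * √(4 - x ^ 2)
    simp only [neg_neg, pow_one, neg_mul, even_two, Even.neg_pow,
      intervalIntegral.integral_neg] at h2
    simp only [pow_one, semicircleMoment]
    rw [show ∫ x in (-2 : ℝ)..2, x * √(4 - x ^ 2) = 0 by linarith, zero_div]
  | more k ih _ =>
    have h2 := integral_pow_mul_sqrt_recurrence k
    have h3 := semicircleMoment_recurrence k
    rw [h1] at ih ⊢
    have h4 : (k : ℝ) + 4 ≠ 0 := by positivity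
    apply mul_left_cancel₀ h4
    rw [h3, ← mul_div_assoc, h2, mul_div_assoc, ih]

theorem integral_cos_sq_mul_log_sin :
    IntervalIntegrable (fun θ => 4 * Real.cos θ ^ 2 * (Real.log 2 + Real.log (Real.sin θ)))
      volume 0 (Real.pi / 2) ∧
    ∫ θ in (0 : ℝ)..(Real.pi / 2), 4 * Real.cos θ ^ 2 * (Real.log 2 + Real.log (Real.sin θ)) =
      -Real.pi / 2 := by
  have hpi := Real.pi_pos
  have hL : IntervalIntegrable (fun θ => Real.log 2 + Real.log (Real.sin θ)) volume 0
      (Real.pi / 2) := intervalIntegrable_const.add intervalIntegrable_log_sin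
  have hcos : IntervalIntegrable (fun θ => 2 * Real.cos θ ^ 2) volume 0 (Real.pi / 2) := by
    apply Continuous.intervalIntegrable; fun_prop
  have hL2 : IntervalIntegrable (fun θ => 2 * Real.cos (2 * θ) *
      (Real.log 2 + Real.log (Real.sin θ))) volume 0 (Real.pi / 2) :=
    hL.continuousOn_mul (by fun_prop)
  -- The primitive is sin 2θ · log(2 sin θ), zero at both ends. It is expanded so that the
  -- continuity of y log y at 0 applies. Since 4cos²θ = 2cos 2θ + 2 and log(2 sin θ) has integral
  -- zero, only −∫ 2cos²θ remains.
  have h := intervalIntegral.integral_eq_sub_of_hasDerivAt_of_le (a := 0) (b := Real.pi / 2)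
    (f := fun θ => 2 * Real.cos θ * (Real.sin θ * Real.log 2 +
      Real.sin θ * Real.log (Real.sin θ)))
    (f' := fun θ => 2 * Real.cos (2 * θ) * (Real.log 2 + Real.log (Real.sin θ)) +
      2 * Real.cos θ ^ 2) (by positivity)
    (by have := Real.continuous_mul_log.comp Real.continuous_sin
        simp only [Function.comp_def] at this
        fun_prop)
    (fun θ hθ => by
      have hs : 0 < Real.sin θ := Real.sin_pos_of_pos_of_lt_pi hθ.1 (by linarith [hθ.2])
      have h1 := ((Real.hasDerivAt_cos θ).const_mul 2).mul
        (((Real.hasDerivAt_sin θ).mul_const (Real.log 2)).add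
          ((Real.hasDerivAt_sin θ).mul ((Real.hasDerivAt_sin θ).log hs.ne')))
      convert! h1 using 1
      simp only [Pi.mul_apply, Pi.add_apply]
      rw [Real.cos_two_mul']
      field_simp
      ring)
    (hL2.add hcos)
  rw [intervalIntegral.integral_add hL2 hcos] at h
  simp only [Real.cos_pi_div_two, Real.sin_zero, mul_zero, zero_mul, add_zero, sub_zero] at h
  have h2 : ∫ θ in (0 : ℝ)..(Real.pi / 2), 2 * Real.cos θ ^ 2 = Real.pi / 2 := by
    rw [intervalIntegral.integral_const_mul, integral_cos_sq]
    simp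
    ring
  have h3 : ∫ θ in (0 : ℝ)..(Real.pi / 2), (Real.log 2 + Real.log (Real.sin θ)) = 0 := by
    rw [intervalIntegral.integral_add (g := fun θ => Real.log (Real.sin θ))
      intervalIntegrable_const intervalIntegrable_log_sin,
      integral_log_sin_zero_pi_div_two]
    simp
    ring
  have h4 : (fun θ => 4 * Real.cos θ ^ 2 * (Real.log 2 + Real.log (Real.sin θ))) =
      fun θ => 2 * Real.cos (2 * θ) * (Real.log 2 + Real.log (Real.sin θ)) +
        2 * (Real.log 2 + Real.log (Real.sin θ)) := by
    ext θ
    rw [Real.cos_two_mul]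
    ring
  rw [h4]
  refine ⟨hL2.add (hL.const_mul 2), ?_⟩
  rw [intervalIntegral.integral_add hL2 (hL.const_mul 2), intervalIntegral.integral_const_mul, h3]
  linarith

theorem intervalIntegrable_sqrt_mul_log (a b : ℝ) :
    IntervalIntegrable (fun x => √(4 - x ^ 2) * Real.log x) volume a b :=
  intervalIntegral.intervalIntegrable_log'.continuousOn_mul (by fun_prop)

theorem integral_sqrt_mul_log_zero_two :
    ∫ x in (0 : ℝ)..2, √(4 - x ^ 2) * Real.log x = -Real.pi / 2 := by
  have hpi := Real.pi_pos
  have hmin : min 0 (Real.pi / 2) = 0 := min_eq_left (by positivity)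
  have hmax : max 0 (Real.pi / 2) = Real.pi / 2 := max_eq_right (by positivity)
  -- Substitution x = 2 sin θ. The open interval is needed: at θ = 0 the convention `Real.log 0 = 0`
  -- breaks the rule for the logarithm of a product.
  have hcongr : Set.EqOn (fun θ => 4 * Real.cos θ ^ 2 * (Real.log 2 + Real.log (Real.sin θ)))
      (fun θ => ((fun x => √(4 - x ^ 2) * Real.log x) ∘ fun θ => 2 * Real.sin θ) θ *
        (2 * Real.cos θ)) (Set.Ioo 0 (Real.pi / 2)) := by
    intro θ hθ
    have hs : 0 < Real.sin θ := Real.sin_pos_of_pos_of_lt_pi hθ.1 (by linarith [hθ.2])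
    have hc : 0 < Real.cos θ := Real.cos_pos_of_mem_Ioo ⟨by linarith [hθ.1], hθ.2⟩
    have h1 : 4 - (2 * Real.sin θ) ^ 2 = (2 * Real.cos θ) ^ 2 := by
      nlinarith [Real.sin_sq_add_cos_sq θ]
    simp only [Function.comp]
    rw [h1, Real.sqrt_sq (by positivity), Real.log_mul two_ne_zero hs.ne']
    ring
  obtain ⟨hi, hI⟩ := integral_cos_sq_mul_log_sin
  have h := intervalIntegral.integral_comp_mul_deriv''' (a := 0) (b := Real.pi / 2)
    (f := fun θ => 2 * Real.sin θ) (f' := fun θ => 2 * Real.cos θ)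
    (g := fun x => √(4 - x ^ 2) * Real.log x) (by fun_prop)
    (fun θ _ => ((Real.hasDerivAt_sin θ).const_mul 2).hasDerivWithinAt)
    (by
      rw [hmin, hmax]
      refine ContinuousOn.mul (by fun_prop) (Real.continuousOn_log.mono ?_)
      rintro _ ⟨θ, hθ, rfl⟩
      have hs : 0 < Real.sin θ := Real.sin_pos_of_pos_of_lt_pi hθ.1 (by linarith [hθ.2])
      exact (mul_pos two_pos hs).ne')
    (by
      rw [Set.uIcc_of_le (by positivity)]
      have h2 := (intervalIntegrable_iff_integrableOn_Icc_of_le (by norm_num)).1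
        (intervalIntegrable_sqrt_mul_log 0 2)
      refine h2.mono_set ?_
      rintro _ ⟨θ, hθ, rfl⟩
      have hs : 0 ≤ Real.sin θ := Real.sin_nonneg_of_nonneg_of_le_pi hθ.1 (by linarith [hθ.2])
      exact ⟨by positivity, by linarith [Real.sin_le_one θ]⟩)
    (by
      rw [Set.uIcc_of_le (by positivity), integrableOn_Icc_iff_integrableOn_Ioo]
      rw [intervalIntegrable_iff_integrableOn_Ioo_of_le (by positivity)] at hi
      exact hi.congr_fun hcongr measurableSet_Ioo)
  simp only [Real.sin_zero, mul_zero, Real.sin_pi_div_two, mul_one] at h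
  rw [← h, ← hI, intervalIntegral.integral_of_le (by positivity),
    intervalIntegral.integral_of_le (by positivity), integral_Ioc_eq_integral_Ioo,
    integral_Ioc_eq_integral_Ioo]
  exact (setIntegral_congr_fun measurableSet_Ioo hcongr).symm

theorem integrable_log_wignerMeasure : Integrable Real.log wignerMeasure := by
  refine integrable_wignerMeasure ?_
  exact intervalIntegral.intervalIntegrable_log'.continuousOn_mul
    continuous_semicircleDensity.continuousOn

/-- `Real.log` is even, so the two halves of the interval contribute equally. This value is the
source of the factor 1/e. -/
theorem integral_log_wignerMeasure : ∫ x, Real.log x ∂wignerMeasure = -1 / 2 := by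
  have h1 : ∫ x in (-2 : ℝ)..0, √(4 - x ^ 2) * Real.log x = -Real.pi / 2 := by
    have h2 := intervalIntegral.integral_comp_neg (a := (-2 : ℝ)) (b := 0)
      fun x => √(4 - x ^ 2) * Real.log x
    simp only [neg_neg, neg_zero, even_two, Even.neg_pow, Real.log_neg_eq_log] at h2
    rw [h2, integral_sqrt_mul_log_zero_two]
  have h3 : (fun x => semicircleDensity x * Real.log x) =
      fun x => √(4 - x ^ 2) * Real.log x / (2 * Real.pi) := by
    ext x
    rw [semicircleDensity]
    ring
  rw [integral_wignerMeasure, h3, intervalIntegral.integral_div,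
    ← intervalIntegral.integral_add_adjacent_intervals (intervalIntegrable_sqrt_mul_log (-2) 0)
      (intervalIntegrable_sqrt_mul_log 0 2), h1, integral_sqrt_mul_log_zero_two]
  have := Real.pi_ne_zero
  field_simp
  norm_num

theorem wignerMeasure_singleton (x : ℝ) : wignerMeasure {x} = 0 :=
  withDensity_absolutelyContinuous _ _ (by simp)

end WignerIntegrals

/-! ### Scaled semicircle laws -/

section SemicircleLaw

theorem integral_semicircleLaw (β : ℝ) {f : ℝ → ℝ} (hf : Continuous f) :
    ∫ x, f x ∂(semicircleLaw β : Measure ℝ) = ∫ x, f (β * x) ∂wignerMeasure :=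
  integral_map (by fun_prop) hf.aestronglyMeasurable

theorem integral_pow_semicircleLaw (β : ℝ) (k : ℕ) :
    ∫ x, x ^ k ∂(semicircleLaw β : Measure ℝ) = semicircleMoment k * β ^ k := by
  rw [integral_semicircleLaw β (continuous_pow k)]
  simp only [mul_pow]
  rw [integral_const_mul, integral_pow_wignerMeasure, mul_comm]

theorem semicircleLaw_compl_Icc {β : ℝ} (h0 : 0 ≤ β) (h1 : β ≤ 1) :
    (semicircleLaw β : Measure ℝ) (Set.Icc (-2) 2)ᶜ = 0 := by
  change (wignerMeasure.map fun x => β * x) _ = 0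
  rw [Measure.map_apply (by fun_prop) measurableSet_Icc.compl, Set.preimage_compl]
  refine measure_mono_null ?_ wignerMeasure_compl_Icc
  refine Set.compl_subset_compl.2 fun x hx' => ?_
  rw [Set.mem_preimage, Set.mem_Icc]
  constructor <;> nlinarith [hx'.1, hx'.2]

theorem tendsto_integral_log_semicircleLaw {α : ℝ} (h0 : 0 < α) (h1 : α ≤ 1) :
    Tendsto (fun m : ℕ => ∫ x, Real.log (1 / ((m : ℝ) + 1) + x ^ 2) ∂(semicircleLaw √α : Measure ℝ))
      atTop (𝓝 (Real.log α - 1)) := by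
  have hcont : ∀ m : ℕ, Continuous fun x : ℝ => Real.log (1 / ((m : ℝ) + 1) + x ^ 2) := fun m =>
    Continuous.log (by fun_prop) fun x => by positivity
  simp only [integral_semicircleLaw _ (hcont _), mul_pow, Real.sq_sqrt h0.le]
  have hae : ∀ᵐ x ∂wignerMeasure, x ∈ Set.Icc (-2 : ℝ) 2 ∧ x ≠ 0 := by
    refine (ae_mem_Icc_of_measure_compl_eq_zero wignerMeasure_compl_Icc).and ?_
    rw [ae_iff]
    simp [wignerMeasure_singleton]
  have hlim : ∫ x, (Real.log α + 2 * Real.log x) ∂wignerMeasure = Real.log α - 1 := by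
    rw [integral_add (by simp) (integrable_log_wignerMeasure.const_mul 2), integral_const_mul,
      integral_log_wignerMeasure]
    simp
    ring
  rw [← hlim]
  -- On the support the integrand lies between log(αx²) and log 5, where 5 = 1 + 4 comes from
  -- 1/(m+1) ≤ 1 and αx² ≤ 4.
  refine tendsto_integral_of_dominated_convergence
    (fun x => |Real.log α + 2 * Real.log x| + Real.log 5) (fun m => ?_) ?_ (fun m => ?_) ?_
  · exact (Continuous.log (by fun_prop) fun x => by positivity).aestronglyMeasurable
  · exact (((integrable_const _).add (integrable_log_wignerMeasure.const_mul 2)).abs).add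
      (integrable_const _)
  · filter_upwards [hae] with x hx
    have hx2 : 0 < x ^ 2 := by have := hx.2; positivity
    have he : Real.log α + 2 * Real.log x = Real.log (α * x ^ 2) := by
      rw [Real.log_mul h0.ne' hx2.ne', Real.log_pow]
      norm_num
    have hm : 0 < 1 / ((m : ℝ) + 1) := by positivity
    have hm1 : 1 / ((m : ℝ) + 1) ≤ 1 := by
      rw [div_le_one (by positivity)]
      linarith [(Nat.cast_nonneg m : (0 : ℝ) ≤ m)]
    have hlow : Real.log (α * x ^ 2) ≤ Real.log (1 / ((m : ℝ) + 1) + α * x ^ 2) :=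
      Real.log_le_log (by positivity) (by linarith)
    have hx4 : x ^ 2 ≤ 4 := by nlinarith [hx.1.1, hx.1.2]
    have hup : Real.log (1 / ((m : ℝ) + 1) + α * x ^ 2) ≤ Real.log 5 :=
      Real.log_le_log (by positivity) (by nlinarith)
    have h5 : 0 ≤ Real.log 5 := Real.log_nonneg (by norm_num)
    rw [he, Real.norm_eq_abs, abs_le]
    constructor
    · linarith [neg_abs_le (Real.log (α * x ^ 2))]
    · linarith [abs_nonneg (Real.log (α * x ^ 2))]
  · filter_upwards [hae] with x hx
    have hx2 : 0 < x ^ 2 := by have := hx.2; positivity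
    have he : Real.log α + 2 * Real.log x = Real.log (0 + α * x ^ 2) := by
      rw [zero_add, Real.log_mul h0.ne' hx2.ne', Real.log_pow]
      norm_num
    rw [he]
    exact (tendsto_one_div_add_atTop_nhds_zero_nat.add_const _).log (by positivity)

end SemicircleLaw

/-! ### Monotone approximation of the extended logarithmic integral -/

section ExtendedLog

theorem extendedLogAbs_of_ne_zero {x : ℝ} (hx : x ≠ 0) : extendedLogAbs x = (Real.log x : EReal) := by
  rw [extendedLogAbs, ENNReal.log_ofReal_of_pos (abs_pos.2 hx), Real.log_abs]

theorem extendedLogAbs_zero : extendedLogAbs 0 = ⊥ := by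
  simp [extendedLogAbs]

theorem tendsto_half_log_extendedLogAbs (x : ℝ) :
    Tendsto (fun m : ℕ => ((Real.log (1 / ((m : ℝ) + 1) + x ^ 2) / 2 : ℝ) : EReal)) atTop
      (𝓝 (extendedLogAbs x)) := by
  rcases eq_or_ne x 0 with rfl | hx
  · rw [extendedLogAbs_zero, EReal.tendsto_coe_nhds_bot_iff]
    have h : Tendsto (fun m : ℕ => 1 / ((m : ℝ) + 1)) atTop (𝓝[>] 0) :=
      tendsto_nhdsWithin_iff.2 ⟨tendsto_one_div_add_atTop_nhds_zero_nat,
        Eventually.of_forall fun m => by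
          rw [Set.mem_Ioi]
          positivity⟩
    have h2 := Real.tendsto_log_nhdsGT_zero.comp h
    refine (h2.atBot_div_const two_pos).congr fun m => ?_
    simp
  · have h2 : 0 < x ^ 2 := by positivity
    rw [extendedLogAbs_of_ne_zero hx,
      show Real.log x = Real.log (0 + x ^ 2) / 2 by rw [zero_add, Real.log_pow]; norm_num]
    refine (continuous_coe_real_ereal.tendsto _).comp (Tendsto.div_const ?_ 2)
    exact (tendsto_one_div_add_atTop_nhds_zero_nat.add_const _).log (by positivity)

theorem antitone_half_log (x : ℝ) :
    Antitone fun m : ℕ => Real.log (1 / ((m : ℝ) + 1) + x ^ 2) / 2 := by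
  intro m n hmn
  simp only
  gcongr

/-- As m grows, ½ log(1/(m+1) + x²) decreases to log|x|. Positive parts converge by domination by
the term m = 0, negative parts by monotone convergence, possibly to +∞. -/
theorem tendsto_integral_log_extendedIntegral {μ : Measure ℝ} [IsFiniteMeasure μ]
    (hμ : μ (Set.Icc (-2) 2)ᶜ = 0) :
    Tendsto (fun m : ℕ => ((∫ x, Real.log (1 / ((m : ℝ) + 1) + x ^ 2) ∂μ : ℝ) : EReal)) atTop
      (𝓝 (2 * extendedIntegral μ extendedLogAbs)) := by
  have hcont : ∀ m : ℕ, Continuous fun x : ℝ => Real.log (1 / ((m : ℝ) + 1) + x ^ 2) / 2 :=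
    fun m => (Continuous.log (by fun_prop) fun x => by positivity).div_const 2
  have hint : ∀ m : ℕ, Integrable (fun x : ℝ => Real.log (1 / ((m : ℝ) + 1) + x ^ 2) / 2) μ :=
    fun m => (hcont m).integrable_of_measure_compl_Icc_eq_zero hμ
  have hpos : Tendsto (fun m : ℕ => ∫⁻ x,
      ENNReal.ofReal (Real.log (1 / ((m : ℝ) + 1) + x ^ 2) / 2) ∂μ) atTop
      (𝓝 (∫⁻ x, (extendedLogAbs x).toENNReal ∂μ)) := by
    refine tendsto_lintegral_of_dominated_convergence
      (fun x => ENNReal.ofReal (Real.log (1 / (((0 : ℕ) : ℝ) + 1) + x ^ 2) / 2))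
      (fun m => (hcont m).measurable.ennreal_ofReal) (fun m => ?_) (hint 0).lintegral_lt_top.ne ?_
    · exact Eventually.of_forall fun x =>
        ENNReal.ofReal_le_ofReal (antitone_half_log x (Nat.zero_le m))
    · exact Eventually.of_forall fun x =>
        (EReal.continuous_toENNReal.tendsto _).comp (tendsto_half_log_extendedLogAbs x)
  have hneg : Tendsto (fun m : ℕ => ∫⁻ x,
      ENNReal.ofReal (-(Real.log (1 / ((m : ℝ) + 1) + x ^ 2) / 2)) ∂μ) atTop
      (𝓝 (∫⁻ x, (-extendedLogAbs x).toENNReal ∂μ)) := by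
    refine lintegral_tendsto_of_tendsto_of_monotone
      (fun m => (hcont m).neg.measurable.ennreal_ofReal.aemeasurable) ?_ ?_
    · exact Eventually.of_forall fun x m n hmn =>
        ENNReal.ofReal_le_ofReal (neg_le_neg (antitone_half_log x hmn))
    · exact Eventually.of_forall fun x =>
        (EReal.continuous_toENNReal.tendsto _).comp
          ((continuous_neg.tendsto _).comp (tendsto_half_log_extendedLogAbs x))
  have hfin : ∫⁻ x, (extendedLogAbs x).toENNReal ∂μ ≠ ⊤ := by
    refine ne_top_of_le_ne_top (hint 0).lintegral_lt_top.ne (lintegral_mono fun x => ?_)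
    refine EReal.toENNReal_le_toENNReal (y := ((_ : ℝ) : EReal)) ?_
    exact le_of_tendsto (tendsto_half_log_extendedLogAbs x) (Eventually.of_forall fun m =>
      EReal.coe_le_coe_iff.2 (antitone_half_log x (Nat.zero_le m)))
  have hsub : Tendsto (fun m : ℕ => ((∫⁻ x,
        ENNReal.ofReal (Real.log (1 / ((m : ℝ) + 1) + x ^ 2) / 2) ∂μ : ℝ≥0∞) : EReal) -
      ((∫⁻ x, ENNReal.ofReal (-(Real.log (1 / ((m : ℝ) + 1) + x ^ 2) / 2)) ∂μ : ℝ≥0∞) : EReal))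
      atTop (𝓝 (extendedIntegral μ extendedLogAbs)) := by
    rw [extendedIntegral]
    simp only [sub_eq_add_neg]
    -- The limit of the positive parts is finite, so ∞ − ∞ is excluded and addition is continuous
    -- there.
    refine (EReal.continuousAt_add (p := (_, _)) (Or.inl ?_) (Or.inl ?_)).tendsto.comp
      (((continuous_coe_ennreal_ereal.tendsto _).comp hpos).prodMk_nhds
        ((continuous_neg.tendsto _).comp
          ((continuous_coe_ennreal_ereal.tendsto _).comp hneg)))
    · simpa using hfin
    · exact EReal.coe_ennreal_ne_bot _
  refine (EReal.Tendsto.const_mul hsub (Or.inl (EReal.coe_ne_bot 2))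
    (Or.inl (EReal.coe_ne_top 2))).congr fun m => ?_
  · have h1 : ∫ x, Real.log (1 / ((m : ℝ) + 1) + x ^ 2) ∂μ =
        2 * ∫ x, Real.log (1 / ((m : ℝ) + 1) + x ^ 2) / 2 ∂μ := by
      rw [← integral_const_mul]
      congr 1
      ext x
      ring
    have hneg_ne : ∫⁻ x, ENNReal.ofReal (-(Real.log (1 / ((m : ℝ) + 1) + x ^ 2) / 2)) ∂μ ≠ ⊤ :=
      (hint m).neg.lintegral_lt_top.ne
    rw [h1, integral_eq_lintegral_pos_part_sub_lintegral_neg_part (hint m), EReal.coe_mul,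
      EReal.coe_sub, EReal.coe_ennreal_toReal (hint m).lintegral_lt_top.ne,
      EReal.coe_ennreal_toReal hneg_ne]

end ExtendedLog

namespace SimpleGraph

/-! ### Upper bounds for the number of matchings -/

section Main

variable {V : ℕ → Type*} [∀ n, Fintype (V n)] [∀ n, Nonempty (V n)] {G : ∀ n, SimpleGraph (V n)}
  [∀ n, DecidableRel (G n).Adj] {d : ℕ → ℝ}

/-- Once 1/d_n ≤ ε, replacing 1/d_n by ε only increases the integrand, and the new one is fixed and
continuous, so weak convergence applies to it. -/
theorem eventually_log_totalMatchings_lt (hadm : ∀ n, (G n).IsAdmissible (d n))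
    (hd : Tendsto d atTop atTop) {ρ : ProbabilityMeasure ℝ}
    (hρ : (ρ : Measure ℝ) (Set.Icc (-2) 2)ᶜ = 0)
    (hlim : Tendsto (fun n => (G n).matchingProbabilityMeasure (d n)) atTop (𝓝 ρ))
    {ε c : ℝ} (hε : 0 < ε) (hc : ∫ x, Real.log (ε + x ^ 2) ∂(ρ : Measure ℝ) < c) :
    ∀ᶠ n in atTop, Real.log (((G n).totalMatchings : ℝ) ^
      ((2 : ℝ) / (Fintype.card (V n) : ℝ)) / d n) < c := by
  have hcont : ∀ ε : ℝ, 0 < ε → Continuous fun x : ℝ => Real.log (ε + x ^ 2) := fun ε hε =>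
    Continuous.log (by fun_prop) fun x => by positivity
  have h1 := ProbabilityMeasure.tendsto_integral_of_tendsto_of_measure_compl_Icc (by norm_num)
    (μ := fun n => (G n).matchingProbabilityMeasure (d n))
    (fun n => (hadm n).matchingMeasure_compl_Icc) hρ hlim (hcont ε hε)
  filter_upwards [h1.eventually_lt_const hc, hd.eventually_ge_atTop ε⁻¹] with n hn hdn
  have hd0 := (hadm n).pos
  rw [(hadm n).log_totalMatchings_eq_integral.2]
  have := (G n).isProbabilityMeasure_matchingMeasure (d n)
  refine lt_of_le_of_lt (integral_mono
    ((hcont _ (inv_pos.2 hd0)).integrable_of_measure_compl_Icc_eq_zero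
      (hadm n).matchingMeasure_compl_Icc)
    ((hcont _ hε).integrable_of_measure_compl_Icc_eq_zero
      (hadm n).matchingMeasure_compl_Icc) fun x => ?_) hn
  have : (d n)⁻¹ ≤ ε := inv_le_of_inv_le₀ hε hdn
  have : 0 < (d n)⁻¹ := inv_pos.2 hd0
  exact Real.log_le_log (by positivity) (by linarith)

theorem limsup_log_totalMatchings_le (hadm : ∀ n, (G n).IsAdmissible (d n))
    (hd : Tendsto d atTop atTop) {ρ : ProbabilityMeasure ℝ}
    (hρ : (ρ : Measure ℝ) (Set.Icc (-2) 2)ᶜ = 0)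
    (hlim : Tendsto (fun n => (G n).matchingProbabilityMeasure (d n)) atTop (𝓝 ρ)) :
    limsup (fun n => ((Real.log (((G n).totalMatchings : ℝ) ^
        ((2 : ℝ) / (Fintype.card (V n) : ℝ)) / d n) : ℝ) : EReal)) atTop ≤
      2 * extendedIntegral (ρ : Measure ℝ) extendedLogAbs := by
  refine ge_of_tendsto (tendsto_integral_log_extendedIntegral hρ) (Eventually.of_forall fun m => ?_)
  refine EReal.le_of_forall_lt_iff_le.1 fun c hc => limsup_le_of_le (h := ?_)
  filter_upwards [eventually_log_totalMatchings_lt hadm hd hρ hlim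
    (ε := 1 / ((m : ℝ) + 1)) (by positivity) (EReal.coe_lt_coe_iff.1 hc)] with n hn
  exact EReal.coe_le_coe_iff.2 hn.le

theorem _root_.exists_integral_log_semicircleLaw_lt {α c : ℝ} (h0 : 0 ≤ α) (h1 : α ≤ 1)
    (hc : α / Real.exp 1 < c) :
    ∃ ε : ℝ, 0 < ε ∧ ∫ x, Real.log (ε + x ^ 2) ∂(semicircleLaw √α : Measure ℝ) < Real.log c := by
  rcases h0.eq_or_lt with rfl | hα
  · have hc0 : 0 < c := by simpa using hc
    -- For α = 0 the law is the point mass at 0 and the integral is log ε, so any ε below `c` works.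
    refine ⟨c / 2, by positivity, ?_⟩
    rw [integral_semicircleLaw _ (Continuous.log (by fun_prop) fun x => by positivity)]
    simp only [Real.sqrt_zero, zero_mul, ne_eq, OfNat.ofNat_ne_zero, not_false_eq_true, zero_pow,
      add_zero, integral_const, probReal_univ, one_smul]
    exact Real.log_lt_log (by positivity) (by linarith)
  · have hlog : Real.log α - 1 < Real.log c := by
      have := Real.log_lt_log (by positivity) hc
      rwa [Real.log_div hα.ne' (Real.exp_ne_zero 1), Real.log_exp] at this
    obtain ⟨m, hm⟩ :=
      ((tendsto_integral_log_semicircleLaw hα h1).eventually_lt_const hlog).exists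
    exact ⟨1 / ((m : ℝ) + 1), by positivity, hm⟩

theorem tendsto_matchingProbabilityMeasure_semicircleLaw (hadm : ∀ n, (G n).IsAdmissible (d n))
    (hd : Tendsto d atTop atTop) {α : ℝ} (h0 : 0 ≤ α) (h1 : α ≤ 1) (h : IsAsympRegular G d α) :
    Tendsto (fun n => (G n).matchingProbabilityMeasure (d n)) atTop (𝓝 (semicircleLaw √α)) := by
  refine ProbabilityMeasure.tendsto_of_tendsto_moments
    (fun n => (hadm n).matchingMeasure_compl_Icc)
    (semicircleLaw_compl_Icc (Real.sqrt_nonneg α) (Real.sqrt_le_one.2 h1)) fun k => ?_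
  rw [integral_pow_semicircleLaw]
  exact tendsto_moment_matchingMeasure hadm hd (h.tendsto_average_branchCoeff hadm h0 h1 k)

/-- Comparing with each real c > α/e, rather than with log(α/e), treats α = 0 together with α > 0,
since log c is always a genuine logarithm. -/
theorem limsup_totalMatchings_le (hadm : ∀ n, (G n).IsAdmissible (d n))
    (hd : Tendsto d atTop atTop) {α : ℝ} (h0 : 0 ≤ α) (h1 : α ≤ 1) (h : IsAsympRegular G d α) :
    limsup (fun n => ((((G n).totalMatchings : ℝ) ^
        ((2 : ℝ) / (Fintype.card (V n) : ℝ)) / d n : ℝ) : EReal)) atTop ≤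
      ((α / Real.exp 1 : ℝ) : EReal) := by
  refine EReal.le_of_forall_lt_iff_le.1 fun c hc => limsup_le_of_le (h := ?_)
  have hc := EReal.coe_lt_coe_iff.1 hc
  have hc0 : 0 < c := lt_of_le_of_lt (by positivity) hc
  obtain ⟨ε, hε, hlt⟩ := exists_integral_log_semicircleLaw_lt h0 h1 hc
  filter_upwards [eventually_log_totalMatchings_lt hadm hd
    (semicircleLaw_compl_Icc (Real.sqrt_nonneg α) (Real.sqrt_le_one.2 h1))
    (tendsto_matchingProbabilityMeasure_semicircleLaw hadm hd h0 h1 h) hε hlt] with n hn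
  have hpos : 0 < ((G n).totalMatchings : ℝ) ^ ((2 : ℝ) / (Fintype.card (V n) : ℝ)) / d n :=
    div_pos (Real.rpow_pos_of_pos (hadm n).log_totalMatchings_eq_integral.1 _) (hadm n).pos
  exact EReal.coe_le_coe_iff.2 ((Real.log_lt_log_iff hpos hc0).1 hn).le

end Main

end SimpleGraph

theorem mainTheorem4 {V : ℕ → Type*} [∀ n, Fintype (V n)] [∀ n, Nonempty (V n)]
    (G : ∀ n, SimpleGraph (V n)) [∀ n, DecidableRel (G n).Adj] (d : ℕ → ℝ)
    (hadm : ∀ n, (G n).IsAdmissible (d n)) (hd : Tendsto d atTop atTop) :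
    (∀ n, IsProbabilityMeasure ((G n).matchingMeasure (d n))) ∧
    (TreeDensitiesConverge G d →
      ∃ ρ : ProbabilityMeasure ℝ,
        (ρ : Measure ℝ) (Set.Icc (-2) 2)ᶜ = 0 ∧
        Tendsto (fun n => (G n).matchingFiniteMeasure (d n)) atTop (𝓝 ρ.toFiniteMeasure) ∧
        limsup (fun n => ((Real.log (((G n).totalMatchings : ℝ) ^
            ((2 : ℝ) / (Fintype.card (V n) : ℝ)) / d n) : ℝ) : EReal)) atTop ≤
          2 * extendedIntegral ((ρ : Measure ℝ).restrict (Set.Icc (-2) 2)) extendedLogAbs) ∧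
    (∀ α : ℝ, 0 ≤ α → α ≤ 1 → IsAsympRegular G d α →
      Tendsto (fun n => (G n).matchingFiniteMeasure (d n)) atTop
        (𝓝 (semicircleLaw (√α)).toFiniteMeasure) ∧
      limsup (fun n => ((((G n).totalMatchings : ℝ) ^
          ((2 : ℝ) / (Fintype.card (V n) : ℝ)) / d n : ℝ) : EReal)) atTop ≤
        ((α / Real.exp 1 : ℝ) : EReal)) := by
  refine ⟨fun n => (G n).isProbabilityMeasure_matchingMeasure (d n), fun h => ?_,
    fun α h0 h1 h => ⟨?_, SimpleGraph.limsup_totalMatchings_le hadm hd h0 h1 h⟩⟩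
  · obtain ⟨ρ, hρ, hlim⟩ := SimpleGraph.exists_tendsto_matchingProbabilityMeasure hadm hd h
    refine ⟨ρ, hρ, ?_, ?_⟩
    · exact (ProbabilityMeasure.tendsto_nhds_iff_toFiniteMeasure_tendsto_nhds _).1 hlim
    -- The limit measure has no mass off [−2, 2], so the restriction changes nothing.
    · rw [Measure.restrict_eq_self_of_ae_mem (ae_mem_Icc_of_measure_compl_eq_zero hρ)]
      exact SimpleGraph.limsup_log_totalMatchings_le hadm hd hρ hlim
  · exact (ProbabilityMeasure.tendsto_nhds_iff_toFiniteMeasure_tendsto_nhds _).1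
      (SimpleGraph.tendsto_matchingProbabilityMeasure_semicircleLaw hadm hd h0 h1 h)
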